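/- Let $(\mathcal X,d_{\mathcal X})$ and $(\mathcal Y,\delta)$ be complete separable metric spaces, let $(\varepsilon_i)_{i\ge 1}$ be independent copies of a $\mathcal Y$-valued random variable $\varepsilon$ with law $\mathbb P_\varepsilon$, and let $X_1$ be an $\mathcal X$-valued random variable with law $\mathbb P_{X_1}$, independent of $(\varepsilon_i)_{i\ge 2}$. Let $X_k=F_k(X_{k-1},\varepsilon_k)$ for $k\ge 2$, where the measurable maps $F_k:\mathcal X\times\mathcal Y\to\mathcal X$ satisfy, for all $k\ge 2$, $x,x'\in\mathcal X$ and $y,y'\in\mathcal Y$, $$\mathbb E\big[d_{\mathcal X}(F_k(x,\varepsilon_1),F_k(x',\varepsilon_1))\big]\le \rho_k\, d_{\mathcal X}(x,x'),\qquad d_{\mathcal X}(F_k(x,y),F_k(x,y'))\le \tau_k\,\delta(y,y')+\xi_k,$$ with $\rho_k\in[0,1)$, $\tau_k\ge 0$ and $\xi_k\ge 0$. Let $p\in[1,\infty]$, $d\ge 1$, $n\ge 2$, and let $f:\mathcal X^n\to\mathbb R^d$ satisfy $$\|f(x_1,\dots,x_n)-f(x_1',\dots,x_n')\|_p\le \sum_{i=1}^n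 d_{\mathcal X}(x_i,x_i').$$ Put $S_n=f(X_1,\dots,X_n)-\mathbb E[f(X_1,\dots,X_n)]$ and $$K_{k,n}=\sum_{j=k}^{n}\ \prod_{l=k+1}^{j}\rho_l,\qquad G_{X_1}(x)=\int d_{\mathcal X}(x,x')\,\mathbb P_{X_1}(dx'),\qquad G_\varepsilon(y)=\int \delta(y,y')\,\mathbb P_\varepsilon(dy'),$$ $$I_1(x)=d\;\mathbb P\Big(G_{X_1}(X_1)\ge \frac{x}{2K_{1,n}}\Big).$$ Assume that $\mathbb E[(G_\varepsilon(\varepsilon))^2]\le A_1$ for a constant $A_1>0$, and let $V_n\ge 0$ and $\delta_n$ be given by $$V_n^2=2\sum_{k=2}^n K_{k,n}^2\big(\tau_k^2A_1+\xi_k^2\big),\qquad \delta_n=\max\{K_{k,n}\tau_k,\ K_{k,n}\xi_k:\ k=2,\dots,n\},$$ where $\delta_n>0$ is assumed. Then for all $x,y>0$, $$\mathbb P\big(\|S_n\|_p\ge d^{1/p}x\big)\le I_1(x)+2d\,H_n\Big(\frac{x}{2(y+1)\delta_n},\frac{V_n}{(y+1)\delta_n}\Big)+2d\,\mathbb P\Big(\max_{2\le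 k\le n}G_\varepsilon(\varepsilon_k)>y\Big),$$ where $$H_n(x,v)=\left\{\Big(\frac{v^2}{x+v^2}\Big)^{x+v^2}\Big(\frac{n}{n-x}\Big)^{n-x}\right\}^{\frac{n}{n+v^2}}\mathbf 1_{\{x\le n\}},$$ with the convention $(+\infty)^0=1$ (which applies when $x=n$). In particular, if $G_\varepsilon(\varepsilon)\le T$ almost surely for a constant $T>0$, then for all $x>0$, $$\mathbb P\big(\|S_n\|_p\ge d^{1/p}x\big)\le I_1(x)+2d\,H_n\Big(\frac{x}{2(T+1)\delta_n},\frac{V_n}{(T+1)\delta_n}\Big).$$ (Here $d^{1/p}=1$ when $p=\infty$, and $G_{X_1}$ and $G_\varepsilon$ are allowed to take the value $+\infty$; if $G_{X_1}\equiv+\infty$, then $I_1(x)=d$ and the bounds are trivial.) -/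

import Mathlib

open MeasureTheory ProbabilityTheory
open scoped ENNReal

noncomputable section

/-- The function `y ↦ ∫ dist(y, y') μ(dy')`, with values in `[0, ∞]`. With `μ` the law of `X₁` this
is `G_{X₁}`, and with `μ` the law of `ε` it is `G_ε`. -/
def meanDist {E : Type*} [MetricSpace E] [MeasurableSpace E] (μ : Measure E) (y : E) : ℝ≥0∞ :=
  ∫⁻ y', edist y y' ∂μ

/-- `K_{k,n} = 1 + ρ_{k+1} + ρ_{k+1} ρ_{k+2} + ⋯ + ρ_{k+1} ⋯ ρ_n` for `1 ≤ k ≤ n`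
(so `K_{n,n} = 1`). -/
def lipK (ρ : ℕ → ℝ) (k n : ℕ) : ℝ :=
  ∑ j ∈ Finset.Icc k n, ∏ l ∈ Finset.Icc (k + 1) j, ρ l

/-- `V_n`, the nonnegative root of `V_n² = 2 ∑_{k=2}^n K_{k,n}² (τ_k² A₁ + ξ_k²)`. -/
def hoeffdingV (ρ τ ξ : ℕ → ℝ) (A₁ : ℝ) (n : ℕ) : ℝ :=
  √(2 * ∑ k ∈ Finset.Icc 2 n, lipK ρ k n ^ 2 * (τ k ^ 2 * A₁ + ξ k ^ 2))

/-- `δ_n = max {K_{k,n} τ_k, K_{k,n} ξ_k : k = 2, …, n}`. -/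
def hoeffdingDelta (ρ τ ξ : ℕ → ℝ) (n : ℕ) (hn : 2 ≤ n) : ℝ :=
  (Finset.Icc 2 n).sup' (Finset.nonempty_Icc.2 hn)
    (fun k => max (lipK ρ k n * τ k) (lipK ρ k n * ξ k))

/-- Hoeffding's function
`H_n(x,v) = {(v²/(x+v²))^{x+v²} (n/(n-x))^{n-x}}^{n/(n+v²)} 1_{x ≤ n}`.
At `x = n` the second factor is `0 ^ 0 = 1` in Lean, in agreement with the convention
`(+∞)^0 = 1`. -/
def hoeffdingH (n : ℕ) (x v : ℝ) : ℝ :=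
  if x ≤ n then
    ((v ^ 2 / (x + v ^ 2)) ^ (x + v ^ 2) * ((n : ℝ) / (n - x)) ^ ((n : ℝ) - x)) ^
      ((n : ℝ) / (n + v ^ 2))
  else 0

section Chain

variable {Ω : Type*} [MeasurableSpace Ω] (P : Measure Ω)
  {𝒳 : Type*} [MetricSpace 𝒳] [MeasurableSpace 𝒳]

/-- The centred variable `S_n = f(X₁, …, X_n) - 𝔼[f(X₁, …, X_n)]`, with values in `ℝ^d` carrying
the `ℓ^p` norm. The expectation is a Bochner integral. For the chains considered here `f(X₁, …, X_n)`
is integrable as soon as `G_{X₁}` is finite at one point; otherwise `G_{X₁}` is identically `∞`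
and `I₁(x) = d`, whatever value the expectation is given. -/
def centredSum {p : ℝ≥0∞} [Fact (1 ≤ p)] {d n : ℕ}
    (f : (Fin n → 𝒳) → PiLp p (fun _ : Fin d => ℝ)) (X : ℕ → Ω → 𝒳) (ω : Ω) :
    PiLp p (fun _ : Fin d => ℝ) :=
  f (fun i => X (i + 1) ω) - ∫ ω', f (fun i => X (i + 1) ω') ∂P

/-- `I₁(x) = d · ℙ(G_{X₁}(X₁) ≥ x / (2 K_{1,n}))`. -/
def initialTerm (d n : ℕ) (ρ : ℕ → ℝ) (X₁ : Ω → 𝒳) (x : ℝ) : ℝ :=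
  d * P.real {ω | ENNReal.ofReal (x / (2 * lipK ρ 1 n)) ≤ meanDist (P.map X₁) (X₁ ω)}

end Chain

end

/-! Averaging a signed coordinate of `f` backwards over the innovations gives functions of ever
shorter initial segments of the path (`averageAfter`). They play the role of conditional
expectations, so the coordinate is an initial part, a function of `X₁` alone, plus a telescoping sum
of centred increments (`sum_pathIncrement_eq`). One averaging turns a Lipschitz constant κ in the
last coordinate into 1 + ρκ (`lipschitzUpTo_averageStep`), which is the recursion of `K_{k,n}`.
Hence the k-th increment is at most `K_{k,n} (τ_k G_ε(ε_k) + ξ_k)`, its second moment given the past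
is at most `2 K_{k,n}² (τ_k² A₁ + ξ_k²)`, and the initial part deviates from its mean by at most
`K_{1,n} G_{X₁}(X₁)`.

Where every `G_ε(ε_k)` is at most `y`, the increments are at most `c = (y+1) δ_n`, so dividing by
`c` and truncating at 1 loses nothing there. A truncated increment has nonpositive mean given the
past, and its exponential moment is at most that of the centred law on {-t, 1}
(`integral_exp_mul_le_twoPointMgf`). The latter is concave in t (`concaveOn_twoPointMgf`), so equal
variances are the worst case, and the optimal Chernoff exponent produces exactly `H_n`. Conditioning
is replaced by Fubini, since the stopped path is independent of the next innovation.

A deviation `x` of one coordinate is shared equally between the initial part and the increments; a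
union bound over coordinates and signs concludes. -/

set_option linter.unusedSectionVars false

/-! ### The two-point law and Hoeffding's function -/

/-- The remainder of the first-order Taylor expansion of `exp` in integral form. -/
lemma exp_sub_one_sub_eq_integral (z : ℝ) :
    Real.exp z - 1 - z = z ^ 2 * ∫ s in (0 : ℝ)..1, (1 - s) * Real.exp (s * z) := by
  have hderiv : ∀ s ∈ Set.uIcc (0 : ℝ) 1,
      HasDerivAt (fun s => ((1 - s) * z + 1) * Real.exp (s * z))
        (z ^ 2 * ((1 - s) * Real.exp (s * z))) s := by
    intro s _
    have h1 : HasDerivAt (fun s : ℝ => (1 - s) * z + 1) (-z) s := by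
      simpa using (((hasDerivAt_id s).const_sub 1).mul_const z).add_const 1
    have h2 : HasDerivAt (fun s : ℝ => Real.exp (s * z)) (Real.exp (s * z) * z) s := by
      simpa using ((hasDerivAt_id s).mul_const z).exp
    exact (h1.mul h2).congr_deriv (by ring)
  rw [← intervalIntegral.integral_const_mul, intervalIntegral.integral_eq_sub_of_hasDerivAt hderiv]
  · simp; ring
  · exact Continuous.intervalIntegrable (by fun_prop) _ _

/-- `z ↦ (exp z - 1 - z) / z²` is monotone, with denominators cleared. -/
lemma exp_sub_one_sub_mul_sq_le {z w : ℝ} (h : z ≤ w) :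
    (Real.exp z - 1 - z) * w ^ 2 ≤ z ^ 2 * (Real.exp w - 1 - w) := by
  rw [exp_sub_one_sub_eq_integral z, exp_sub_one_sub_eq_integral w]
  have hmono : ∫ s in (0 : ℝ)..1, (1 - s) * Real.exp (s * z) ≤
      ∫ s in (0 : ℝ)..1, (1 - s) * Real.exp (s * w) := by
    refine intervalIntegral.integral_mono_on zero_le_one
      (Continuous.intervalIntegrable (by fun_prop) _ _)
      (Continuous.intervalIntegrable (by fun_prop) _ _) fun s hs => ?_
    have h0 : 0 ≤ 1 - s := by linarith [hs.2]
    have h1 : s * z ≤ s * w := mul_le_mul_of_nonneg_left h hs.1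
    gcongr
  nlinarith [mul_le_mul_of_nonneg_left hmono (mul_nonneg (sq_nonneg z) (sq_nonneg w))]

/-- The moment generating function at `r` of the centred law on `{-t, 1}`, which has variance `t`. -/
noncomputable def twoPointMgf (r t : ℝ) : ℝ :=
  (Real.exp (-r * t) + t * Real.exp r) / (1 + t)

lemma twoPointMgf_pos {r t : ℝ} (ht : 0 ≤ t) : 0 < twoPointMgf r t := by
  unfold twoPointMgf; positivity

@[simp] lemma twoPointMgf_zero_right (r : ℝ) : twoPointMgf r 0 = 1 := by
  simp [twoPointMgf]

/-- This form removes the denominator: `t` now enters only through an exponent that is affine in it.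
-/
lemma twoPointMgf_eq_integral (r : ℝ) {t : ℝ} (ht : 0 ≤ t) :
    twoPointMgf r t =
      Real.exp r * (1 - ∫ u in (0 : ℝ)..1, r * Real.exp (-(r * (1 + t)) * u)) := by
  have h1 : (0 : ℝ) < 1 + t := by linarith
  have hderiv : ∀ u ∈ Set.uIcc (0 : ℝ) 1,
      HasDerivAt (fun u => -(Real.exp (-(r * (1 + t)) * u)) / (1 + t))
        (r * Real.exp (-(r * (1 + t)) * u)) u := by
    intro u _
    have h2 : HasDerivAt (fun u : ℝ => Real.exp (-(r * (1 + t)) * u))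
        (Real.exp (-(r * (1 + t)) * u) * (-(r * (1 + t)))) u := by
      simpa using ((hasDerivAt_id u).const_mul (-(r * (1 + t)))).exp
    exact (h2.neg.div_const (1 + t)).congr_deriv (by field_simp)
  rw [intervalIntegral.integral_eq_sub_of_hasDerivAt hderiv
    (Continuous.intervalIntegrable (by fun_prop) _ _)]
  have h3 : Real.exp (-r * t) = Real.exp r * Real.exp (-(r * (1 + t))) := by
    rw [← Real.exp_add]; ring_nf
  rw [twoPointMgf, h3]
  simp
  field_simp
  ring

/-- In the integral form the integrand is `exp` of an affine function of `t`, hence convex, and it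
is subtracted. -/
lemma concaveOn_twoPointMgf {r : ℝ} (hr : 0 ≤ r) :
    ConcaveOn ℝ (Set.Ici 0) (twoPointMgf r) := by
  refine ⟨convex_Ici 0, fun s hs t ht a b ha hb hab => ?_⟩
  have hst : (0 : ℝ) ≤ a • s + b • t :=
    add_nonneg (mul_nonneg ha hs) (mul_nonneg hb ht)
  rw [twoPointMgf_eq_integral r hs, twoPointMgf_eq_integral r ht, twoPointMgf_eq_integral r hst]
  have key : ∫ u in (0 : ℝ)..1, r * Real.exp (-(r * (1 + (a • s + b • t))) * u) ≤
      a * (∫ u in (0 : ℝ)..1, r * Real.exp (-(r * (1 + s)) * u)) +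
        b * (∫ u in (0 : ℝ)..1, r * Real.exp (-(r * (1 + t)) * u)) := by
    rw [← intervalIntegral.integral_const_mul, ← intervalIntegral.integral_const_mul,
      ← intervalIntegral.integral_add (Continuous.intervalIntegrable (by fun_prop) _ _)
        (Continuous.intervalIntegrable (by fun_prop) _ _)]
    refine intervalIntegral.integral_mono_on zero_le_one
      (Continuous.intervalIntegrable (by fun_prop) _ _)
      (Continuous.intervalIntegrable (by fun_prop) _ _) fun u _ => ?_
    have := convexOn_exp.2 (Set.mem_univ (-(r * (1 + s)) * u)) (Set.mem_univ (-(r * (1 + t)) * u))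
      ha hb hab
    have harg : -(r * (1 + (a • s + b • t))) * u =
        a • (-(r * (1 + s)) * u) + b • (-(r * (1 + t)) * u) := by
      simp only [smul_eq_mul]
      linear_combination (r * u) * hab
    rw [harg]
    simp only [smul_eq_mul] at this ⊢
    nlinarith
  simp only [smul_eq_mul] at key ⊢
  have he := Real.exp_pos r
  nlinarith [mul_le_mul_of_nonneg_left key he.le]

/-- The product of the `twoPointMgf` is largest when all the variances are equal. -/
lemma prod_twoPointMgf_le {r : ℝ} (hr : 0 ≤ r) {n : ℕ} (hn : 0 < n) {t : ℕ → ℝ}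
    (ht : ∀ i, 0 ≤ t i) :
    ∏ i ∈ Finset.range n, twoPointMgf r (t i) ≤
      twoPointMgf r ((∑ i ∈ Finset.range n, t i) / n) ^ n := by
  have hn' : (0 : ℝ) < n := by exact_mod_cast hn
  have hw : ∑ _i ∈ Finset.range n, (1 / n : ℝ) = 1 := by
    simp [hn'.ne']
  have hpos : ∀ i, 0 ≤ twoPointMgf r (t i) := fun i => (twoPointMgf_pos (ht i)).le
  -- AM–GM with equal weights, then Jensen for the concave `twoPointMgf r`; taking `n`-th powers
  -- gives the claim.
  have h1 := Real.geom_mean_le_arith_mean_weighted (Finset.range n) (fun _ => (1 / n : ℝ))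
    (fun i => twoPointMgf r (t i)) (fun _ _ => by positivity) hw (fun i _ => hpos i)
  have h2 := (concaveOn_twoPointMgf hr).le_map_sum (t := Finset.range n)
    (w := fun _ => (1 / n : ℝ)) (p := t) (fun _ _ => by positivity) hw (fun i _ => ht i)
  have h3 : ∑ i ∈ Finset.range n, (1 / n : ℝ) • t i = (∑ i ∈ Finset.range n, t i) / n := by
    rw [← Finset.smul_sum, smul_eq_mul]; ring
  rw [h3] at h2
  simp only [smul_eq_mul] at h2
  have h4 := h1.trans h2
  rw [Real.finsetProd_rpow _ _ (fun i _ => hpos i)] at h4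
  have h5 := pow_le_pow_left₀ (Real.rpow_nonneg (Finset.prod_nonneg fun i _ => hpos i) _) h4 n
  rwa [one_div, Real.rpow_inv_natCast_pow (Finset.prod_nonneg fun i _ => hpos i) hn.ne'] at h5

lemma hoeffdingH_nonneg (n : ℕ) (x v : ℝ) (hx : 0 ≤ x) : 0 ≤ hoeffdingH n x v := by
  unfold hoeffdingH
  split_ifs with h
  · have : (0 : ℝ) ≤ n - x := by linarith
    positivity
  · exact le_rfl

/-- Hoeffding's function is attained as a Chernoff bound. -/
lemma exists_exp_mul_twoPointMgf_pow_eq {n : ℕ} {x v : ℝ} (hx : 0 < x) (hxn : x < n)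
    (hv : 0 < v) :
    ∃ r, 0 < r ∧ Real.exp (-r * x) * twoPointMgf r (v ^ 2 / n) ^ n = hoeffdingH n x v := by
  have hn : (0 : ℝ) < n := hx.trans hxn
  have hnx : 0 < (n : ℝ) - x := by linarith
  set w := v ^ 2 with hw
  have hwpos : 0 < w := by positivity
  set t := w / n with ht
  have htpos : 0 < t := by positivity
  -- The value of `exp (r * (1 + t))` at the stationary point of `r ↦ -r * x + n * log (twoPointMgf
  -- r t)`.
  set u : ℝ := (x + w) / w * (n / (n - x)) with hu
  have hu1 : 1 < u := by
    rw [hu, div_mul_div_comm, one_lt_div (by positivity)]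
    nlinarith
  have hupos : 0 < u := by linarith
  refine ⟨Real.log u / (1 + t), div_pos (Real.log_pos hu1) (by linarith), ?_⟩
  set r := Real.log u / (1 + t) with hr
  have hru : r * (1 + t) = Real.log u := by rw [hr]; field_simp
  have hB : twoPointMgf r t = Real.exp (-r * t) * (n / (n - x)) := by
    have h1 : Real.exp r = Real.exp (-r * t) * u := by
      rw [← Real.exp_log hupos, ← hru, ← Real.exp_add]; ring_nf
    rw [twoPointMgf, h1, hu, ht]
    field_simp
    ring
  have hlogu : Real.log u = Real.log (n / (n - x)) - Real.log (w / (x + w)) := by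
    rw [hu, Real.log_mul (by positivity) (by positivity), ← inv_div w, Real.log_inv]
    ring
  unfold hoeffdingH
  rw [if_pos hxn.le, hB, ← hw]
  have hq : (0 : ℝ) < n / (n - x) := by positivity
  have hs : (0 : ℝ) < w / (x + w) := by positivity
  rw [← Real.exp_log (show 0 < ((w / (x + w)) ^ (x + w) * ((n : ℝ) / (n - x)) ^ ((n : ℝ) - x)) by
    positivity), ← Real.exp_mul, Real.log_mul (by positivity) (by positivity), Real.log_rpow hs,
    Real.log_rpow hq]
  conv_lhs => rw [← Real.exp_log hq, ← Real.exp_add, ← Real.exp_nat_mul, ← Real.exp_add]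
  congr 1
  have hr' : r = (Real.log (n / (n - x)) - Real.log (w / (x + w))) * (n / (n + w)) := by
    rw [← hlogu, hr, ht]; field_simp
  rw [hr', ht]
  field_simp
  ring

/-! ### Exponential moments and the tail of a sum of increments -/

/-- Hoeffding's bound on the moment generating function of a variable bounded above by `1` with
nonpositive mean and second moment at most `t`. -/
lemma integral_exp_mul_le_twoPointMgf {E : Type*} [MeasurableSpace E] {μ : Measure E}
    [IsProbabilityMeasure μ] {Y : E → ℝ} {r t : ℝ} (hr : 0 < r) (ht : 0 ≤ t)
    (hYint : Integrable Y μ) (hYsq : Integrable (fun y => Y y ^ 2) μ) (hY1 : ∀ y, Y y ≤ 1)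
    (hmean : ∫ y, Y y ∂μ ≤ 0) (hvar : ∫ y, Y y ^ 2 ∂μ ≤ t) :
    ∫⁻ y, ENNReal.ofReal (Real.exp (r * Y y)) ∂μ ≤ ENNReal.ofReal (twoPointMgf r t) := by
  set w := r * (1 + t) with hw
  have h1t : 0 < 1 + t := by linarith
  have hwpos : 0 < w := mul_pos hr h1t
  -- Chosen so that the quadratic majorant `q` of `exp (r * Y)` is tangent at `Y = -t` and exact at
  -- `Y = 1`; the bound is then sharp for the two-point law.
  set γ := (Real.exp w - 1 - w) / (1 + t) ^ 2 with hγ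
  have hγ0 : 0 ≤ γ := div_nonneg (by linarith [Real.add_one_le_exp w]) (by positivity)
  set q : E → ℝ := fun y =>
    Real.exp (-r * t) * ((1 + r * t + γ * t ^ 2) + (r + 2 * γ * t) * Y y + γ * Y y ^ 2) with hq
  have hle : ∀ y, Real.exp (r * Y y) ≤ q y := by
    intro y
    have h := exp_sub_one_sub_mul_sq_le (z := r * (Y y + t)) (w := w)
      (mul_le_mul_of_nonneg_left (by linarith [hY1 y]) hr.le)
    have h2 : Real.exp (r * (Y y + t)) - 1 - r * (Y y + t) ≤ γ * (Y y + t) ^ 2 := by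
      have h3 : (Real.exp (r * (Y y + t)) - 1 - r * (Y y + t)) * w ^ 2 ≤
          (γ * (Y y + t) ^ 2) * w ^ 2 := by
        refine h.trans (le_of_eq ?_)
        rw [hγ, hw]; field_simp
      exact le_of_mul_le_mul_right h3 (by positivity)
    have h4 : Real.exp (r * Y y) = Real.exp (-r * t) * Real.exp (r * (Y y + t)) := by
      rw [← Real.exp_add]; ring_nf
    rw [h4, hq]
    exact mul_le_mul_of_nonneg_left (by linarith) (Real.exp_pos _).le
  have hqint : Integrable q μ :=
    (((integrable_const _).add (hYint.const_mul _)).add (hYsq.const_mul _)).const_mul _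
  have hq0 : ∀ y, 0 ≤ q y := fun y => (Real.exp_pos _).le.trans (hle y)
  calc ∫⁻ y, ENNReal.ofReal (Real.exp (r * Y y)) ∂μ
      ≤ ∫⁻ y, ENNReal.ofReal (q y) ∂μ := lintegral_mono fun y => ENNReal.ofReal_le_ofReal (hle y)
    _ = ENNReal.ofReal (∫ y, q y ∂μ) :=
        (ofReal_integral_eq_lintegral_ofReal hqint (Filter.Eventually.of_forall hq0)).symm
    _ ≤ _ := ENNReal.ofReal_le_ofReal ?_
  have hint : ∫ y, q y ∂μ = Real.exp (-r * t) * ((1 + r * t + γ * t ^ 2) +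
      (r + 2 * γ * t) * ∫ y, Y y ∂μ + γ * ∫ y, Y y ^ 2 ∂μ) := by
    have hi : Integrable (fun y => (1 + r * t + γ * t ^ 2) + (r + 2 * γ * t) * Y y) μ :=
      (integrable_const _).add (hYint.const_mul _)
    rw [hq, integral_const_mul, integral_add hi (hYsq.const_mul _),
      integral_add (integrable_const _) (hYint.const_mul _), integral_const_mul,
      integral_const_mul]
    simp
  have heq : twoPointMgf r t = Real.exp (-r * t) * (1 + r * t + γ * t ^ 2 + γ * t) := by
    have h1 : Real.exp r = Real.exp (-r * t) * Real.exp w := by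
      rw [← Real.exp_add, hw]; ring_nf
    rw [twoPointMgf, h1, hγ, hw]
    field_simp
    ring
  rw [hint, heq]
  refine mul_le_mul_of_nonneg_left ?_ (Real.exp_pos _).le
  have h5 : (r + 2 * γ * t) * ∫ y, Y y ∂μ ≤ 0 :=
    mul_nonpos_of_nonneg_of_nonpos (by positivity) hmean
  nlinarith [mul_le_mul_of_nonneg_left hvar hγ0]

/-- Truncating from above can only lower the mean, and it does not increase absolute values because
the level 1 is positive. -/
lemma integral_min_one_bounds {E : Type*} [MeasurableSpace E] {μ : Measure E}
    [IsProbabilityMeasure μ] {Y : E → ℝ} (hY : Integrable Y μ)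
    (hYsq : Integrable (fun y => Y y ^ 2) μ) (hmean : ∫ y, Y y ∂μ = 0) (c : ℝ) :
    Integrable (fun y => min (Y y / c) 1) μ ∧ Integrable (fun y => min (Y y / c) 1 ^ 2) μ ∧
      ∫ y, min (Y y / c) 1 ∂μ ≤ 0 ∧
      ∫ y, min (Y y / c) 1 ^ 2 ∂μ ≤ (∫ y, Y y ^ 2 ∂μ) / c ^ 2 := by
  have h1 : Integrable (fun y => min (Y y / c) 1) μ :=
    (hY.div_const c).inf (integrable_const (1 : ℝ))
  have hsq : ∀ y, min (Y y / c) 1 ^ 2 ≤ Y y ^ 2 / c ^ 2 := by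
    intro y
    rw [← div_pow]
    refine sq_le_sq.2 ?_
    rcases le_total (Y y / c) 1 with h | h
    · rw [min_eq_left h]
    · rw [min_eq_right h, abs_one]
      exact h.trans (le_abs_self _)
  have h2 : Integrable (fun y => min (Y y / c) 1 ^ 2) μ := by
    refine (hYsq.div_const (c ^ 2)).mono' (h1.1.pow 2) (Filter.Eventually.of_forall fun y => ?_)
    rw [Real.norm_of_nonneg (sq_nonneg _)]
    exact hsq y
  refine ⟨h1, h2, ?_, ?_⟩
  · calc ∫ y, min (Y y / c) 1 ∂μ ≤ ∫ y, Y y / c ∂μ :=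
          integral_mono h1 (hY.div_const c) fun y => min_le_left _ _
      _ = 0 := by rw [integral_div, hmean, zero_div]
  · rw [← integral_div]
    exact integral_mono h2 (hYsq.div_const _) hsq

section

variable {Ω : Type*} [MeasurableSpace Ω] {P : Measure Ω} [IsProbabilityMeasure P]
  {S 𝒴 : Type*} [MeasurableSpace S] [MeasurableSpace 𝒴] {μ : Measure 𝒴} [IsProbabilityMeasure μ]

/-- One step of the exponential supermartingale: by independence the law of `(A, B)` is a product,
so the one-variable bound applies with the state frozen, and `W` carries the past. -/
lemma lintegral_mul_exp_min_le {A : Ω → S} {B : Ω → 𝒴} (hA : Measurable A) (hB : Measurable B)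
    (hAB : IndepFun A B P) (hBμ : P.map B = μ) {D : S → 𝒴 → ℝ}
    (hD : Measurable (Function.uncurry D)) (hint : ∀ a, Integrable (D a) μ)
    (hsqint : ∀ a, Integrable (fun y => D a y ^ 2) μ) (hmean : ∀ a, ∫ y, D a y ∂μ = 0)
    {σ : ℝ} (hσ : 0 ≤ σ) (hvar : ∀ a, ∫ y, D a y ^ 2 ∂μ ≤ σ) {c r : ℝ} (hc : 0 < c) (hr : 0 < r)
    {W : S → ℝ≥0∞} (hW : Measurable W) :
    ∫⁻ ω, W (A ω) * ENNReal.ofReal (Real.exp (r * min (D (A ω) (B ω) / c) 1)) ∂P ≤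
      ENNReal.ofReal (twoPointMgf r (σ / c ^ 2)) * ∫⁻ ω, W (A ω) ∂P := by
  have hmeasE : Measurable fun q : S × 𝒴 =>
      ENNReal.ofReal (Real.exp (r * min (D q.1 q.2 / c) 1)) := by
    have : Measurable fun q : S × 𝒴 => D q.1 q.2 := hD
    fun_prop
  have hmeas : Measurable fun q : S × 𝒴 =>
      W q.1 * ENNReal.ofReal (Real.exp (r * min (D q.1 q.2 / c) 1)) :=
    (hW.comp measurable_fst).mul hmeasE
  have hmap : P.map (fun ω => (A ω, B ω)) = (P.map A).prod μ := by
    rw [(indepFun_iff_map_prod_eq_prod_map_map hA.aemeasurable hB.aemeasurable).1 hAB, hBμ]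
  have := Measure.isProbabilityMeasure_map (μ := P) hA.aemeasurable
  calc ∫⁻ ω, W (A ω) * ENNReal.ofReal (Real.exp (r * min (D (A ω) (B ω) / c) 1)) ∂P
      = ∫⁻ q, W q.1 * ENNReal.ofReal (Real.exp (r * min (D q.1 q.2 / c) 1))
          ∂(P.map (fun ω => (A ω, B ω))) := (lintegral_map hmeas (hA.prodMk hB)).symm
    _ = ∫⁻ a, ∫⁻ y, W a * ENNReal.ofReal (Real.exp (r * min (D a y / c) 1)) ∂μ ∂(P.map A) := by
        rw [hmap, lintegral_prod _ hmeas.aemeasurable]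
    _ ≤ ∫⁻ a, ENNReal.ofReal (twoPointMgf r (σ / c ^ 2)) * W a ∂(P.map A) := by
        refine lintegral_mono fun a => ?_
        have hma : Measurable fun y => ENNReal.ofReal (Real.exp (r * min (D a y / c) 1)) :=
          hmeasE.comp measurable_prodMk_left
        rw [lintegral_const_mul _ hma, mul_comm]
        obtain ⟨h1, h2, h3, h4⟩ := integral_min_one_bounds (hint a) (hsqint a) (hmean a) c
        gcongr
        exact integral_exp_mul_le_twoPointMgf hr (by positivity) h1 h2 (fun y => min_le_right _ _)
          h3 (h4.trans (by gcongr; exact hvar a))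
    _ = _ := by rw [lintegral_const_mul _ hW, lintegral_map hW hA]

/-- Hoeffding's inequality for sums of increments `D k (A k) (η k)` where `η k` is independent of
the state `A k`, and the past increments are functions of the state. -/
theorem measureReal_sum_ge_le_hoeffdingH {A : ℕ → Ω → S} {η : ℕ → Ω → 𝒴} {D : ℕ → S → 𝒴 → ℝ}
    {φ : ℕ → S → ℝ} {σ : ℕ → ℝ} {n N : ℕ} (hN : N < n)
    (hA : ∀ k, Measurable (A k)) (hη : ∀ k, Measurable (η k))
    (hAη : ∀ k, IndepFun (A k) (η k) P) (hημ : ∀ k, P.map (η k) = μ)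
    (hD : ∀ k < N, Measurable (Function.uncurry (D k))) (hφ : ∀ k < N, Measurable (φ k))
    (hφD : ∀ k < N, ∀ j < k, ∀ ω, φ j (A k ω) = D j (A j ω) (η j ω))
    (hint : ∀ k < N, ∀ a, Integrable (D k a) μ)
    (hsqint : ∀ k < N, ∀ a, Integrable (fun y => D k a y ^ 2) μ)
    (hmean : ∀ k < N, ∀ a, ∫ y, D k a y ∂μ = 0) (hσ : ∀ k, 0 ≤ σ k)
    (hvar : ∀ k < N, ∀ a, ∫ y, D k a y ^ 2 ∂μ ≤ σ k) (hσpos : 0 < ∑ k ∈ Finset.range N, σ k)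
    {c x : ℝ} (hc : 0 < c) (hx : 0 < x) :
    P.real {ω | x ≤ ∑ k ∈ Finset.range N, D k (A k ω) (η k ω) ∧
        ∀ k < N, D k (A k ω) (η k ω) ≤ c} ≤
      hoeffdingH n (x / c) (√(∑ k ∈ Finset.range N, σ k) / c) := by
  have hn : 0 < n := by omega
  have hn' : (0 : ℝ) < n := by exact_mod_cast hn
  -- With `N < n` increments, each at most `c`, the sum stays below `n * c`. The event is therefore
  -- empty even at `x / c = n`, and the Chernoff exponent is needed only for `x / c < n`.
  rcases le_or_gt (n : ℝ) (x / c) with hxn | hxn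
  · have hempty : {ω | x ≤ ∑ k ∈ Finset.range N, D k (A k ω) (η k ω) ∧
        ∀ k < N, D k (A k ω) (η k ω) ≤ c} = ∅ := by
      refine Set.eq_empty_iff_forall_notMem.2 fun ω hω => ?_
      have h1 : ∑ k ∈ Finset.range N, D k (A k ω) (η k ω) ≤ N * c := by
        simpa using Finset.sum_le_card_nsmul (Finset.range N) _ c
          fun k hk => hω.2 k (Finset.mem_range.1 hk)
      have h2 : (N : ℝ) * c < n * c := by gcongr
      have h3 := (le_div_iff₀ hc).1 hxn
      linarith [hω.1]
    rw [hempty, measureReal_empty]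
    exact hoeffdingH_nonneg _ _ _ (by positivity)
  set V := √(∑ k ∈ Finset.range N, σ k) with hV
  have hVpos : 0 < V := Real.sqrt_pos.2 hσpos
  obtain ⟨r, hr, hrH⟩ := exists_exp_mul_twoPointMgf_pow_eq (div_pos hx hc) hxn (div_pos hVpos hc)
  let m : ℕ → Ω → ℝ := fun k ω => min (D k (A k ω) (η k ω) / c) 1
  have hm : ∀ k < N, Measurable (m k) := fun k hk =>
    (((hD k hk).comp ((hA k).prodMk (hη k))).div_const c).min measurable_const
  have hmgf : ∀ k ≤ N, ∫⁻ ω, ENNReal.ofReal (Real.exp (r * ∑ j ∈ Finset.range k, m j ω)) ∂P ≤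
      ∏ j ∈ Finset.range k, ENNReal.ofReal (twoPointMgf r (σ j / c ^ 2)) := by
    intro k
    induction k with
    | zero => intro _; simp
    | succ k ih =>
      intro hk
      -- The past exponential weight, written through `φ` as a function of the current state alone.
      let W : S → ℝ≥0∞ := fun a =>
        ENNReal.ofReal (Real.exp (r * ∑ j ∈ Finset.range k, min (φ j a / c) 1))
      have hW : Measurable W := by
        refine ENNReal.measurable_ofReal.comp (Real.measurable_exp.comp
          (Measurable.const_mul (Finset.measurable_fun_sum _ fun j hj => ?_) r))
        exact ((hφ j (by have := Finset.mem_range.1 hj; omega)).div_const c).min measurable_const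
      have hWA : ∀ ω, W (A k ω) =
          ENNReal.ofReal (Real.exp (r * ∑ j ∈ Finset.range k, m j ω)) := by
        intro ω
        simp only [W, m]
        congr 3
        refine Finset.sum_congr rfl fun j hj => ?_
        rw [hφD k (by omega) j (Finset.mem_range.1 hj) ω]
      have hstep := lintegral_mul_exp_min_le (hA k) (hη k) (hAη k) (hημ k) (hD k (by omega))
        (hint k (by omega)) (hsqint k (by omega)) (hmean k (by omega)) (hσ k) (hvar k (by omega))
        hc hr hW
      rw [Finset.prod_range_succ, mul_comm]
      refine le_trans (le_of_eq ?_) (hstep.trans (mul_le_mul_right (?_) _))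
      · refine lintegral_congr fun ω => ?_
        rw [hWA, ← ENNReal.ofReal_mul (Real.exp_pos _).le, ← Real.exp_add, Finset.sum_range_succ,
          mul_add]
      · simp only [hWA]
        exact ih (by omega)
  have hprod : ∏ j ∈ Finset.range N, twoPointMgf r (σ j / c ^ 2) ≤
      twoPointMgf r ((V / c) ^ 2 / n) ^ n := by
    -- Padding from `N` to `n` factors: a zero variance contributes the factor 1, so the average can
    -- be taken over `n`.
    let t : ℕ → ℝ := fun j => if j < N then σ j / c ^ 2 else 0
    have ht : ∀ j, 0 ≤ t j := fun j => by
      have := hσ j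
      simp only [t]; split_ifs <;> positivity
    have hsub : Finset.range N ⊆ Finset.range n := Finset.range_mono hN.le
    have h1 : ∏ j ∈ Finset.range n, twoPointMgf r (t j) =
        ∏ j ∈ Finset.range N, twoPointMgf r (σ j / c ^ 2) := by
      rw [← Finset.prod_subset hsub fun j _ hj => by simp [t, Finset.mem_range.not.1 hj]]
      exact Finset.prod_congr rfl fun j hj => by simp [t, Finset.mem_range.1 hj]
    have h2 : ∑ j ∈ Finset.range n, t j = (V / c) ^ 2 := by
      rw [← Finset.sum_subset hsub fun j _ hj => by simp [t, Finset.mem_range.not.1 hj], div_pow,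
        hV, Real.sq_sqrt hσpos.le, Finset.sum_div]
      exact Finset.sum_congr rfl fun j hj => by simp [t, Finset.mem_range.1 hj]
    rw [← h1, ← h2]
    exact prod_twoPointMgf_le hr.le hn ht
  rw [← hrH]
  have hmeasE : Measurable fun ω => ENNReal.ofReal (Real.exp (r * ∑ j ∈ Finset.range N, m j ω)) :=
    ENNReal.measurable_ofReal.comp (Real.measurable_exp.comp (Measurable.const_mul
      (Finset.measurable_fun_sum _ fun j hj => hm j (Finset.mem_range.1 hj)) r))
  have hmarkov := mul_meas_ge_le_lintegral (μ := P) hmeasE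
    (ENNReal.ofReal (Real.exp (r * (x / c))))
  have hsubset : {ω | x ≤ ∑ k ∈ Finset.range N, D k (A k ω) (η k ω) ∧
        ∀ k < N, D k (A k ω) (η k ω) ≤ c} ⊆
      {ω | ENNReal.ofReal (Real.exp (r * (x / c))) ≤
        ENNReal.ofReal (Real.exp (r * ∑ j ∈ Finset.range N, m j ω))} := by
    intro ω hω
    refine ENNReal.ofReal_le_ofReal (Real.exp_le_exp.2 (mul_le_mul_of_nonneg_left ?_ hr.le))
    -- On this event the truncation is inactive.
    have h1 : ∑ j ∈ Finset.range N, m j ω =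
        (∑ j ∈ Finset.range N, D j (A j ω) (η j ω)) / c := by
      rw [Finset.sum_div]
      refine Finset.sum_congr rfl fun j hj => min_eq_left ?_
      exact (div_le_one hc).2 (hω.2 j (Finset.mem_range.1 hj))
    rw [h1]
    exact div_le_div_of_nonneg_right hω.1 hc.le
  have hbound : ENNReal.ofReal (Real.exp (r * (x / c))) *
      P {ω | x ≤ ∑ k ∈ Finset.range N, D k (A k ω) (η k ω) ∧
        ∀ k < N, D k (A k ω) (η k ω) ≤ c} ≤
      ENNReal.ofReal (twoPointMgf r ((V / c) ^ 2 / n) ^ n) := by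
    refine (mul_le_mul_right (measure_mono hsubset) _).trans (hmarkov.trans
      ((hmgf N le_rfl).trans ?_))
    rw [← ENNReal.ofReal_prod_of_nonneg fun j _ =>
      (twoPointMgf_pos (div_nonneg (hσ j) (sq_nonneg c))).le]
    exact ENNReal.ofReal_le_ofReal hprod
  have hreal := ENNReal.toReal_mono ENNReal.ofReal_ne_top hbound
  rw [ENNReal.toReal_mul, ENNReal.toReal_ofReal (Real.exp_pos _).le,
    ENNReal.toReal_ofReal (pow_nonneg (twoPointMgf_pos (by positivity)).le _)] at hreal
  calc P.real _ = Real.exp (-r * (x / c)) * (Real.exp (r * (x / c)) * P.real _) := by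
        rw [← mul_assoc, ← Real.exp_add]; simp
    _ ≤ _ := mul_le_mul_of_nonneg_left hreal (Real.exp_pos _).le

end

/-! ### Averaging Lipschitz functions of a path over the innovations -/

section

variable {𝒳 𝒴 : Type*} [MetricSpace 𝒳] [TopologicalSpace.SeparableSpace 𝒳]
  [MeasurableSpace 𝒳] [BorelSpace 𝒳] [MetricSpace 𝒴] [TopologicalSpace.SeparableSpace 𝒴]
  [MeasurableSpace 𝒴] [BorelSpace 𝒴]

/-- A random map which contracts on average in the state and is Lipschitz up to a constant in the
innovation, whose law `μ` has a finite first moment. -/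
structure IsAverageContraction (Φ : 𝒳 → 𝒴 → 𝒳) (μ : Measure 𝒴) (r τ ξ : ℝ) : Prop where
  measurable : Measurable (Function.uncurry Φ)
  integrable_dist : ∀ y, Integrable (fun y' => dist y y') μ
  lintegral_edist_le : ∀ u u', ∫⁻ y, edist (Φ u y) (Φ u' y) ∂μ ≤ ENNReal.ofReal r * edist u u'
  dist_le : ∀ u y y', dist (Φ u y) (Φ u y') ≤ τ * dist y y' + ξ
  r_nonneg : 0 ≤ r
  τ_nonneg : 0 ≤ τ
  ξ_nonneg : 0 ≤ ξ

namespace IsAverageContraction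

variable {Φ : 𝒳 → 𝒴 → 𝒳} {μ : Measure 𝒴} {r τ ξ : ℝ}

lemma integrable_dist_map (h : IsAverageContraction Φ μ r τ ξ) (u u' : 𝒳) :
    Integrable (fun y => dist (Φ u y) (Φ u' y)) μ := by
  have hm : Measurable fun y => dist (Φ u y) (Φ u' y) :=
    (h.measurable.comp measurable_prodMk_left).dist (h.measurable.comp measurable_prodMk_left)
  refine ⟨hm.aestronglyMeasurable, ?_⟩
  rw [hasFiniteIntegral_iff_ofReal (Filter.Eventually.of_forall fun _ => dist_nonneg)]
  simp only [← edist_dist]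
  exact (h.lintegral_edist_le u u').trans_lt
    (ENNReal.mul_lt_top ENNReal.ofReal_lt_top (edist_lt_top _ _))

lemma integral_dist_map_le (h : IsAverageContraction Φ μ r τ ξ) (u u' : 𝒳) :
    ∫ y, dist (Φ u y) (Φ u' y) ∂μ ≤ r * dist u u' := by
  rw [integral_eq_lintegral_of_nonneg_ae (Filter.Eventually.of_forall fun _ => dist_nonneg)
    (h.integrable_dist_map u u').1]
  simp only [← edist_dist]
  refine ENNReal.toReal_le_of_le_ofReal (mul_nonneg h.r_nonneg dist_nonneg)
    ((h.lintegral_edist_le u u').trans (le_of_eq ?_))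
  rw [ENNReal.ofReal_mul h.r_nonneg, edist_dist]

end IsAverageContraction

/-- `g` depends on the coordinates up to `k` only, with Lipschitz constants `1, …, 1, κ`. -/
def LipschitzUpTo (k : ℕ) (κ : ℝ) (g : (ℕ → 𝒳) → ℝ) : Prop :=
  ∀ x x', |g x - g x'| ≤ ∑ i ∈ Finset.range k, dist (x i) (x' i) + κ * dist (x k) (x' k)

/-- The Lipschitz bound does not see coordinates after `k`, so it vanishes for paths that agree up
to `k`. -/
lemma LipschitzUpTo.congr {k : ℕ} {κ : ℝ} {g : (ℕ → 𝒳) → ℝ} (hg : LipschitzUpTo k κ g)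
    {x x' : ℕ → 𝒳} (h : ∀ i ≤ k, x i = x' i) : g x = g x' := by
  have h1 := hg x x'
  rw [Finset.sum_eq_zero (fun i hi => by simp [h i (Finset.mem_range.1 hi).le]), h k le_rfl,
    dist_self, mul_zero, add_zero] at h1
  exact sub_eq_zero.1 (abs_nonpos_iff.1 h1)

/-- Insert the image of the `k`-th coordinate under `Φ` with innovation `y` as coordinate `k + 1`. -/
def extendPath (Φ : 𝒳 → 𝒴 → 𝒳) (k : ℕ) (x : ℕ → 𝒳) (y : 𝒴) : ℕ → 𝒳 :=
  Function.update x (k + 1) (Φ (x k) y)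

lemma measurable_extendPath {Φ : 𝒳 → 𝒴 → 𝒳} (hΦ : Measurable (Function.uncurry Φ)) (k : ℕ) :
    Measurable fun q : (ℕ → 𝒳) × 𝒴 => extendPath Φ k q.1 q.2 := by
  refine measurable_pi_iff.2 fun i => ?_
  by_cases hi : i = k + 1
  · subst hi
    simp only [extendPath, Function.update_self]
    have h1 : Measurable fun q : (ℕ → 𝒳) × 𝒴 => (q.1 k, q.2) := by fun_prop
    exact hΦ.comp h1
  · simp only [extendPath, Function.update_of_ne hi]
    exact (measurable_pi_apply i).comp measurable_fst

/-- Average out the coordinate `k + 1` given the past. -/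
noncomputable def averageStep (Φ : 𝒳 → 𝒴 → 𝒳) (μ : Measure 𝒴) (k : ℕ) (g : (ℕ → 𝒳) → ℝ)
    (x : ℕ → 𝒳) : ℝ :=
  ∫ y, g (extendPath Φ k x y) ∂μ

section Step

variable {Φ : 𝒳 → 𝒴 → 𝒳} {μ : Measure 𝒴} [IsProbabilityMeasure μ] {r τ ξ κ : ℝ} {k : ℕ}
  {g : (ℕ → 𝒳) → ℝ}

lemma abs_sub_extendPath_le (hg : LipschitzUpTo (k + 1) κ g) (x x' : ℕ → 𝒳) (y y' : 𝒴) :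
    |g (extendPath Φ k x y) - g (extendPath Φ k x' y')| ≤
      ∑ i ∈ Finset.range (k + 1), dist (x i) (x' i) + κ * dist (Φ (x k) y) (Φ (x' k) y') := by
  refine (hg _ _).trans (le_of_eq ?_)
  simp only [extendPath, Function.update_self]
  congr 1
  refine Finset.sum_congr rfl fun i hi => ?_
  have : i ≠ k + 1 := (Finset.mem_range.1 hi).ne
  simp [Function.update_of_ne this]

lemma abs_sub_extendPath_innovation_le (hΦ : IsAverageContraction Φ μ r τ ξ) (hκ : 0 ≤ κ)
    (hg : LipschitzUpTo (k + 1) κ g) (x : ℕ → 𝒳) (y y' : 𝒴) :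
    |g (extendPath Φ k x y) - g (extendPath Φ k x y')| ≤ κ * (τ * dist y y' + ξ) := by
  refine (abs_sub_extendPath_le hg x x y y').trans ?_
  simpa using mul_le_mul_of_nonneg_left (hΦ.dist_le (x k) y y') hκ

lemma integrable_extendPath (hΦ : IsAverageContraction Φ μ r τ ξ) (hκ : 0 ≤ κ)
    (hgm : Measurable g) (hg : LipschitzUpTo (k + 1) κ g) (x : ℕ → 𝒳) :
    Integrable (fun y => g (extendPath Φ k x y)) μ := by
  obtain ⟨y₀⟩ : Nonempty 𝒴 := nonempty_of_isProbabilityMeasure μ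
  have hm : Measurable fun y => g (extendPath Φ k x y) :=
    hgm.comp ((measurable_extendPath hΦ.measurable k).comp measurable_prodMk_left)
  have hdom : Integrable (fun y => κ * (τ * dist y₀ y + ξ) + |g (extendPath Φ k x y₀)|) μ :=
    ((((hΦ.integrable_dist y₀).const_mul τ).add (integrable_const ξ)).const_mul κ).add
      (integrable_const _)
  refine hdom.mono' hm.aestronglyMeasurable (Filter.Eventually.of_forall fun y => ?_)
  have h1 := abs_sub_extendPath_innovation_le hΦ hκ hg x y y₀
  rw [dist_comm] at h1
  have h2 := abs_sub_abs_le_abs_sub (g (extendPath Φ k x y)) (g (extendPath Φ k x y₀))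
  rw [Real.norm_eq_abs]
  linarith

lemma measurable_averageStep (hΦ : IsAverageContraction Φ μ r τ ξ) (hgm : Measurable g) :
    Measurable (averageStep Φ μ k g) :=
  (StronglyMeasurable.integral_prod_right (ν := μ)
    (f := fun x y => g (extendPath Φ k x y))
    (hgm.comp (measurable_extendPath hΦ.measurable k)).stronglyMeasurable).measurable

/-- Coordinate `k` acts twice: directly, with constant 1, and through its image under `Φ`, where
contraction on average gives `r * κ`. -/
lemma lipschitzUpTo_averageStep (hΦ : IsAverageContraction Φ μ r τ ξ) (hκ : 0 ≤ κ)
    (hgm : Measurable g) (hg : LipschitzUpTo (k + 1) κ g) :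
    LipschitzUpTo k (1 + r * κ) (averageStep Φ μ k g) := by
  intro x x'
  have hi := integrable_extendPath hΦ hκ hgm hg
  rw [averageStep, averageStep, ← integral_sub (hi x) (hi x')]
  have hdi := hΦ.integrable_dist_map (x k) (x' k)
  calc |∫ y, (g (extendPath Φ k x y) - g (extendPath Φ k x' y)) ∂μ|
      ≤ ∫ y, |g (extendPath Φ k x y) - g (extendPath Φ k x' y)| ∂μ := abs_integral_le_integral_abs
    _ ≤ ∫ y, (∑ i ∈ Finset.range (k + 1), dist (x i) (x' i) +
          κ * dist (Φ (x k) y) (Φ (x' k) y)) ∂μ :=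
        integral_mono ((hi x).sub (hi x')).abs ((integrable_const _).add (hdi.const_mul κ))
          fun y => abs_sub_extendPath_le hg x x' y y
    _ = ∑ i ∈ Finset.range (k + 1), dist (x i) (x' i) +
          κ * ∫ y, dist (Φ (x k) y) (Φ (x' k) y) ∂μ := by
        rw [integral_add (integrable_const _) (hdi.const_mul κ), integral_const_mul]
        simp
    _ ≤ ∑ i ∈ Finset.range (k + 1), dist (x i) (x' i) + κ * (r * dist (x k) (x' k)) := by
        gcongr
        exact hΦ.integral_dist_map_le _ _
    _ = _ := by rw [Finset.sum_range_succ]; ring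

/-- The martingale increment at step `k + 1`. -/
noncomputable def pathIncrement (Φ : 𝒳 → 𝒴 → 𝒳) (μ : Measure 𝒴) (k : ℕ) (g : (ℕ → 𝒳) → ℝ)
    (x : ℕ → 𝒳) (y : 𝒴) : ℝ :=
  g (extendPath Φ k x y) - averageStep Φ μ k g x

lemma measurable_pathIncrement (hΦ : IsAverageContraction Φ μ r τ ξ) (hgm : Measurable g) :
    Measurable (Function.uncurry (pathIncrement Φ μ k g)) :=
  (hgm.comp (measurable_extendPath hΦ.measurable k)).sub
    ((measurable_averageStep hΦ hgm).comp measurable_fst)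

lemma integrable_pathIncrement (hΦ : IsAverageContraction Φ μ r τ ξ) (hκ : 0 ≤ κ)
    (hgm : Measurable g) (hg : LipschitzUpTo (k + 1) κ g) (x : ℕ → 𝒳) :
    Integrable (pathIncrement Φ μ k g x) μ :=
  (integrable_extendPath hΦ hκ hgm hg x).sub (integrable_const _)

lemma integral_pathIncrement (hΦ : IsAverageContraction Φ μ r τ ξ) (hκ : 0 ≤ κ)
    (hgm : Measurable g) (hg : LipschitzUpTo (k + 1) κ g) (x : ℕ → 𝒳) :
    ∫ y, pathIncrement Φ μ k g x y ∂μ = 0 := by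
  simp only [pathIncrement]
  rw [integral_sub (integrable_extendPath hΦ hκ hgm hg x) (integrable_const _)]
  simp [averageStep]

/-- The increment is the mean over a fresh innovation `y'` of the change in `g` when `y'` is
replaced by `y`. -/
lemma abs_pathIncrement_le (hΦ : IsAverageContraction Φ μ r τ ξ) (hκ : 0 ≤ κ)
    (hgm : Measurable g) (hg : LipschitzUpTo (k + 1) κ g) (x : ℕ → 𝒳) (y : 𝒴) :
    |pathIncrement Φ μ k g x y| ≤ κ * (τ * ∫ y', dist y y' ∂μ + ξ) := by
  have hi := integrable_extendPath hΦ hκ hgm hg x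
  have hd := hΦ.integrable_dist y
  have h1 : pathIncrement Φ μ k g x y =
      ∫ y', (g (extendPath Φ k x y) - g (extendPath Φ k x y')) ∂μ := by
    rw [integral_sub (integrable_const _) hi]
    simp [pathIncrement, averageStep]
  have hdi : Integrable (fun y' => κ * (τ * dist y y' + ξ)) μ :=
    ((hd.const_mul τ).add (integrable_const ξ)).const_mul κ
  rw [h1]
  calc |∫ y', (g (extendPath Φ k x y) - g (extendPath Φ k x y')) ∂μ|
      ≤ ∫ y', |g (extendPath Φ k x y) - g (extendPath Φ k x y')| ∂μ := abs_integral_le_integral_abs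
    _ ≤ ∫ y', κ * (τ * dist y y' + ξ) ∂μ :=
        integral_mono ((integrable_const _).sub hi).abs hdi
          fun y' => abs_sub_extendPath_innovation_le hΦ hκ hg x y y'
    _ = _ := by
        rw [integral_const_mul, integral_add (hd.const_mul τ) (integrable_const ξ),
          integral_const_mul]
        simp

/-- The factor 2, which is the one in `V_n²`, comes from `(a + b)² ≤ 2a² + 2b²` applied to the
pointwise bound. -/
lemma integrable_sq_pathIncrement_and_integral_le (hΦ : IsAverageContraction Φ μ r τ ξ)
    (hκ : 0 ≤ κ) (hgm : Measurable g) (hg : LipschitzUpTo (k + 1) κ g)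
    (hsq : Integrable (fun y => (∫ y', dist y y' ∂μ) ^ 2) μ) {A : ℝ}
    (hA : ∫ y, (∫ y', dist y y' ∂μ) ^ 2 ∂μ ≤ A) (x : ℕ → 𝒳) :
    Integrable (fun y => pathIncrement Φ μ k g x y ^ 2) μ ∧
      ∫ y, pathIncrement Φ μ k g x y ^ 2 ∂μ ≤ 2 * (κ ^ 2 * (τ ^ 2 * A + ξ ^ 2)) := by
  have hdom : Integrable (fun y => 2 * (κ ^ 2 * (τ ^ 2 * (∫ y', dist y y' ∂μ) ^ 2 + ξ ^ 2))) μ :=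
    (((hsq.const_mul (τ ^ 2)).add (integrable_const (ξ ^ 2))).const_mul _).const_mul _
  have hle : ∀ y, pathIncrement Φ μ k g x y ^ 2 ≤
      2 * (κ ^ 2 * (τ ^ 2 * (∫ y', dist y y' ∂μ) ^ 2 + ξ ^ 2)) := by
    intro y
    have h1 := pow_le_pow_left₀ (abs_nonneg _) (abs_pathIncrement_le hΦ hκ hgm hg x y) 2
    rw [sq_abs] at h1
    refine h1.trans ?_
    nlinarith [mul_nonneg (sq_nonneg κ) (sq_nonneg (τ * ∫ y', dist y y' ∂μ - ξ))]
  have hm := ((integrable_pathIncrement hΦ hκ hgm hg x).1.pow 2)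
  have hint : Integrable (fun y => pathIncrement Φ μ k g x y ^ 2) μ := by
    refine hdom.mono' hm (Filter.Eventually.of_forall fun y => ?_)
    rw [Real.norm_of_nonneg (sq_nonneg _)]
    exact hle y
  refine ⟨hint, (integral_mono hint hdom hle).trans ?_⟩
  rw [integral_const_mul, integral_const_mul,
    integral_add (hsq.const_mul (τ ^ 2)) (integrable_const _), integral_const_mul]
  simp only [integral_const, probReal_univ, one_smul]
  gcongr

end Step

/-- Average out the coordinates after `N - m`. -/
noncomputable def averageLast (Φ : ℕ → 𝒳 → 𝒴 → 𝒳) (μ : Measure 𝒴) (N : ℕ) (g : (ℕ → 𝒳) → ℝ) :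
    ℕ → (ℕ → 𝒳) → ℝ
  | 0 => g
  | m + 1 => averageStep (Φ (N - (m + 1))) μ (N - (m + 1)) (averageLast Φ μ N g m)

/-- Average out the coordinates after `k`, among the coordinates up to `N`. -/
noncomputable def averageAfter (Φ : ℕ → 𝒳 → 𝒴 → 𝒳) (μ : Measure 𝒴) (N : ℕ) (g : (ℕ → 𝒳) → ℝ)
    (k : ℕ) : (ℕ → 𝒳) → ℝ :=
  averageLast Φ μ N g (N - k)

section Backward

variable {Φ : ℕ → 𝒳 → 𝒴 → 𝒳} {μ : Measure 𝒴} [IsProbabilityMeasure μ] {r τ ξ κ : ℕ → ℝ}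
  {N : ℕ} {g : (ℕ → 𝒳) → ℝ}

lemma averageAfter_self : averageAfter Φ μ N g N = g := by
  simp [averageAfter, averageLast]

lemma averageAfter_eq_step {k : ℕ} (hk : k < N) :
    averageAfter Φ μ N g k = averageStep (Φ k) μ k (averageAfter Φ μ N g (k + 1)) := by
  have h1 : N - k = (N - (k + 1)) + 1 := by omega
  have h2 : N - (N - (k + 1) + 1) = k := by omega
  rw [averageAfter, h1, averageLast, h2]
  rfl

lemma averageAfter_properties (hΦ : ∀ k, IsAverageContraction (Φ k) μ (r k) (τ k) (ξ k))
    (hκ : ∀ k, 0 ≤ κ k) (hκN : κ N = 1) (hκstep : ∀ k < N, κ k = 1 + r k * κ (k + 1))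
    (hgm : Measurable g) (hg : LipschitzUpTo N 1 g) {k : ℕ} (hk : k ≤ N) :
    Measurable (averageAfter Φ μ N g k) ∧ LipschitzUpTo k (κ k) (averageAfter Φ μ N g k) := by
  induction hk using Nat.decreasingInduction with
  | self => rw [averageAfter_self, hκN]; exact ⟨hgm, hg⟩
  | of_succ k hk ih =>
    rw [averageAfter_eq_step hk, hκstep k hk]
    exact ⟨measurable_averageStep (hΦ k) ih.1,
      lipschitzUpTo_averageStep (hΦ k) (hκ _) ih.1 ih.2⟩

end Backward

end

/-! ### Independence of past and next innovation, and the decomposition along the chain -/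

lemma indepFun_prodMk_left {Ω α β γ : Type*} [MeasurableSpace Ω] [MeasurableSpace α]
    [MeasurableSpace β] [MeasurableSpace γ] {P : Measure Ω} [IsProbabilityMeasure P]
    {U : Ω → α} {S : Ω → β} {B : Ω → γ} (hU : Measurable U) (hS : Measurable S)
    (hB : Measurable B) (h : IndepFun U (fun ω => (S ω, B ω)) P) (hSB : IndepFun S B P) :
    IndepFun (fun ω => (U ω, S ω)) B P := by
  have := Measure.isProbabilityMeasure_map (μ := P) hU.aemeasurable
  have := Measure.isProbabilityMeasure_map (μ := P) hS.aemeasurable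
  have := Measure.isProbabilityMeasure_map (μ := P) hB.aemeasurable
  have hUS : IndepFun U S P := h.comp measurable_id measurable_fst
  rw [indepFun_iff_map_prod_eq_prod_map_map (hU.prodMk hS).aemeasurable hB.aemeasurable,
    (indepFun_iff_map_prod_eq_prod_map_map hU.aemeasurable hS.aemeasurable).1 hUS]
  have h1 := (indepFun_iff_map_prod_eq_prod_map_map hU.aemeasurable
    (hS.prodMk hB).aemeasurable).1 h
  rw [(indepFun_iff_map_prod_eq_prod_map_map hS.aemeasurable hB.aemeasurable).1 hSB] at h1
  rw [← ((measurePreserving_prodAssoc (P.map U) (P.map S) (P.map B)).symm).map_eq, ← h1,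
    Measure.map_map (MeasurableEquiv.measurable _) (hU.prodMk (hS.prodMk hB))]
  rfl

section Chain

variable {Ω : Type*} [MeasurableSpace Ω] {P : Measure Ω} [IsProbabilityMeasure P]
  {𝒳 𝒴 : Type*} [MetricSpace 𝒳] [TopologicalSpace.SeparableSpace 𝒳]
  [MeasurableSpace 𝒳] [BorelSpace 𝒳] [MetricSpace 𝒴] [TopologicalSpace.SeparableSpace 𝒴]
  [MeasurableSpace 𝒴] [BorelSpace 𝒴]
  {Φ : ℕ → 𝒳 → 𝒴 → 𝒳} {μ : Measure 𝒴} [IsProbabilityMeasure μ]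
  {Z : ℕ → Ω → 𝒳} {η : ℕ → Ω → 𝒴}

/-- The path of the process stopped at time `k`. -/
def stoppedPath (Z : ℕ → Ω → 𝒳) (k : ℕ) (ω : Ω) : ℕ → 𝒳 := fun i => Z (min i k) ω

lemma measurable_chain (hΦ : ∀ k, Measurable (Function.uncurry (Φ k))) (hZ0 : Measurable (Z 0))
    (hη : ∀ k, Measurable (η k)) (hZ : ∀ k ω, Z (k + 1) ω = Φ k (Z k ω) (η k ω)) (k : ℕ) :
    Measurable (Z k) := by
  induction k with
  | zero => exact hZ0
  | succ k ih =>
    have h1 : Z (k + 1) = fun ω => Function.uncurry (Φ k) (Z k ω, η k ω) := funext (hZ k)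
    rw [h1]
    exact (hΦ k).comp (ih.prodMk (hη k))

lemma measurable_stoppedPath (hZ : ∀ k, Measurable (Z k)) (k : ℕ) :
    Measurable (stoppedPath Z k) :=
  measurable_pi_iff.2 fun i => hZ (min i k)

/-- The stopped path is measurable with respect to `Z 0` and the innovations before `k`, which are
jointly independent of `η k`. -/
lemma indepFun_stoppedPath (hΦ : ∀ k, Measurable (Function.uncurry (Φ k)))
    (hZ0 : Measurable (Z 0)) (hη : ∀ k, Measurable (η k))
    (hZ : ∀ k ω, Z (k + 1) ω = Φ k (Z k ω) (η k ω)) (hη_indep : iIndepFun η P)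
    (hZη : IndepFun (Z 0) (fun ω k => η k ω) P) (k : ℕ) :
    IndepFun (stoppedPath Z k) (η k) P := by
  let S : Ω → Finset.range k → 𝒴 := fun ω j => η j ω
  have hS : Measurable S := measurable_pi_iff.2 fun j => hη j
  have hSB : IndepFun S (η k) P := by
    have h1 := hη_indep.indepFun_finset (Finset.range k) {k} (by simp) hη
    exact h1.comp measurable_id
      (measurable_pi_apply (⟨k, Finset.mem_singleton_self k⟩ : ({k} : Finset ℕ)))
  have hU : IndepFun (Z 0) (fun ω => (S ω, η k ω)) P := by
    have hm : Measurable fun e : ℕ → 𝒴 => ((fun j : Finset.range k => e j), e k) := by fun_prop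
    exact hZη.comp measurable_id hm
  have hUSB := indepFun_prodMk_left hZ0 hS (hη k) hU hSB
  have hle : ∀ i ≤ k, Measurable[MeasurableSpace.comap (fun ω => (Z 0 ω, S ω)) inferInstance]
      (Z i) := by
    intro i
    induction i with
    | zero =>
      intro _
      exact measurable_fst.comp (comap_measurable (fun ω => (Z 0 ω, S ω)))
    | succ i ih =>
      intro hi
      have h1 : Z (i + 1) = fun ω => Function.uncurry (Φ i) (Z i ω, η i ω) := funext (hZ i)
      rw [h1]
      have hηi : Measurable[MeasurableSpace.comap (fun ω => (Z 0 ω, S ω)) inferInstance] (η i) :=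
        ((measurable_pi_apply (⟨i, Finset.mem_range.2 hi⟩ : Finset.range k)).comp
          measurable_snd).comp (comap_measurable (fun ω => (Z 0 ω, S ω)))
      exact (hΦ i).comp (Measurable.prodMk (ih (by omega)) hηi)
  have hA : Measurable[MeasurableSpace.comap (fun ω => (Z 0 ω, S ω)) inferInstance]
      (stoppedPath Z k) :=
    @measurable_pi_lambda _ _ _ (_) _ _ fun i => hle _ (min_le_right i k)
  exact indep_of_indep_of_le_left hUSB hA.comap_le

variable {r τ ξ κ : ℕ → ℝ} {N : ℕ} {f : (ℕ → 𝒳) → ℝ}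

/-- The freedom in `x` serves two purposes: the full path gives the telescoping sum, and a path
stopped later shows that past increments are functions of the current state. -/
lemma pathIncrement_stoppedPath {κ₁ κ₀ : ℝ} {g₁ g₀ : (ℕ → 𝒳) → ℝ} {j : ℕ}
    (hZ : ∀ k ω, Z (k + 1) ω = Φ k (Z k ω) (η k ω)) (hg₁ : LipschitzUpTo (j + 1) κ₁ g₁)
    (hg₀ : LipschitzUpTo j κ₀ g₀) (hg : g₀ = averageStep (Φ j) μ j g₁) (ω : Ω) {x : ℕ → 𝒳}
    (hx : ∀ i ≤ j + 1, x i = Z i ω) :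
    pathIncrement (Φ j) μ j g₁ (stoppedPath Z j ω) (η j ω) = g₁ x - g₀ x := by
  rw [pathIncrement, ← hg]
  congr 1
  · refine hg₁.congr fun i hi => ?_
    rw [hx i hi]
    rcases hi.eq_or_lt with rfl | hi
    · simp [extendPath, stoppedPath, hZ]
    · rw [extendPath, Function.update_of_ne hi.ne, stoppedPath, min_eq_left (by omega)]
  · refine hg₀.congr fun i hi => ?_
    rw [hx i (by omega), stoppedPath, min_eq_left hi]

lemma measurable_integral_dist (μ : Measure 𝒴) [IsProbabilityMeasure μ] :
    Measurable fun y => ∫ y', dist y y' ∂μ :=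
  (StronglyMeasurable.integral_prod_right (ν := μ) (f := fun y y' : 𝒴 => dist y y')
    (measurable_dist (α := 𝒴)).stronglyMeasurable).measurable

lemma integrable_integral_dist (hd : ∀ y, Integrable (fun y' => dist y y') μ) :
    Integrable (fun y => ∫ y', dist y y' ∂μ) μ := by
  obtain ⟨y₀⟩ : Nonempty 𝒴 := nonempty_of_isProbabilityMeasure μ
  refine ((hd y₀).add (integrable_const (∫ y', dist y₀ y' ∂μ))).mono'
    (measurable_integral_dist μ).aestronglyMeasurable (Filter.Eventually.of_forall fun y => ?_)
  rw [Real.norm_of_nonneg (integral_nonneg fun _ => dist_nonneg)]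
  calc ∫ y', dist y y' ∂μ ≤ ∫ y', (dist y₀ y + dist y₀ y') ∂μ :=
        integral_mono (hd y) ((integrable_const _).add (hd y₀)) fun y' => by
          rw [dist_comm y₀ y]; exact dist_triangle _ _ _
    _ = _ := by rw [integral_add (integrable_const _) (hd y₀)]; simp

section

variable (hΦ : ∀ k, IsAverageContraction (Φ k) μ (r k) (τ k) (ξ k))
  (hZ0 : Measurable (Z 0)) (hη : ∀ k, Measurable (η k))
  (hZ : ∀ k ω, Z (k + 1) ω = Φ k (Z k ω) (η k ω)) (hη_indep : iIndepFun η P)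
  (hZη : IndepFun (Z 0) (fun ω k => η k ω) P) (hημ : ∀ k, P.map (η k) = μ)
  (hκ : ∀ k, 0 ≤ κ k) (hκN : κ N = 1) (hκstep : ∀ k < N, κ k = 1 + r k * κ (k + 1))
  (hfm : Measurable f) (hf : LipschitzUpTo N 1 f)

include hΦ hZ hκ hκN hκstep hfm hf in
lemma sum_pathIncrement_eq (ω : Ω) {k : ℕ} (hk : k ≤ N) :
    ∑ j ∈ Finset.range k, pathIncrement (Φ j) μ j (averageAfter Φ μ N f (j + 1))
      (stoppedPath Z j ω) (η j ω) =
    averageAfter Φ μ N f k (fun i => Z i ω) - averageAfter Φ μ N f 0 (fun i => Z i ω) := by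
  rw [← Finset.sum_range_sub fun j => averageAfter Φ μ N f j (fun i => Z i ω)]
  refine Finset.sum_congr rfl fun j hj => ?_
  have hj := Finset.mem_range.1 hj
  exact pathIncrement_stoppedPath hZ
    (averageAfter_properties hΦ hκ hκN hκstep hfm hf (show j + 1 ≤ N by omega)).2
    (averageAfter_properties hΦ hκ hκN hκstep hfm hf (show j ≤ N by omega)).2
    (averageAfter_eq_step (by omega)) ω fun _ _ => rfl

include hΦ hZ0 hη hZ hη_indep hZη hημ hκ hκN hκstep hfm hf in
/-- Upper tail bound for the part of the functional which is driven by the innovations. -/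
theorem measureReal_sub_averageAfter_ge_le
    (hsq : Integrable (fun y => (∫ y', dist y y' ∂μ) ^ 2) μ) {A : ℝ} (hA : 0 < A)
    (hAle : ∫ y, (∫ y', dist y y' ∂μ) ^ 2 ∂μ ≤ A) {δ y x : ℝ} (hδ : 0 < δ)
    (hδτ : ∀ k < N, κ (k + 1) * τ k ≤ δ) (hδξ : ∀ k < N, κ (k + 1) * ξ k ≤ δ)
    (hσpos : 0 < ∑ k ∈ Finset.range N, 2 * (κ (k + 1) ^ 2 * (τ k ^ 2 * A + ξ k ^ 2)))
    (hx : 0 < x) (hy : 0 < y) {n : ℕ} (hN : N < n) :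
    P.real {ω | x ≤ f (fun i => Z i ω) - averageAfter Φ μ N f 0 (fun i => Z i ω) ∧
        ∀ k < N, ∫ y', dist (η k ω) y' ∂μ ≤ y} ≤
      hoeffdingH n (x / ((y + 1) * δ))
        (√(∑ k ∈ Finset.range N, 2 * (κ (k + 1) ^ 2 * (τ k ^ 2 * A + ξ k ^ 2))) /
          ((y + 1) * δ)) := by
  have hp : ∀ {k : ℕ}, k ≤ N → Measurable (averageAfter Φ μ N f k) ∧
      LipschitzUpTo k (κ k) (averageAfter Φ μ N f k) :=
    averageAfter_properties hΦ hκ hκN hκstep hfm hf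
  have hZm := measurable_chain (fun k => (hΦ k).measurable) hZ0 hη hZ
  refine le_trans ?_ (measureReal_sum_ge_le_hoeffdingH (P := P) (μ := μ) (A := stoppedPath Z)
    (η := η) (D := fun j => pathIncrement (Φ j) μ j (averageAfter Φ μ N f (j + 1)))
    (φ := fun j a => averageAfter Φ μ N f (j + 1) a - averageAfter Φ μ N f j a)
    (σ := fun k => 2 * (κ (k + 1) ^ 2 * (τ k ^ 2 * A + ξ k ^ 2))) hN
    (measurable_stoppedPath hZm) hη
    (indepFun_stoppedPath (fun k => (hΦ k).measurable) hZ0 hη hZ hη_indep hZη) hημ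
    (fun k hk => measurable_pathIncrement (hΦ k) (hp hk).1)
    (fun k hk => (hp hk).1.sub (hp hk.le).1)
    (fun k hk j hj ω => ?_)
    (fun k hk => integrable_pathIncrement (hΦ k) (hκ _) (hp hk).1 (hp hk).2)
    (fun k hk a => (integrable_sq_pathIncrement_and_integral_le (hΦ k) (hκ _) (hp hk).1 (hp hk).2
      hsq hAle a).1)
    (fun k hk => integral_pathIncrement (hΦ k) (hκ _) (hp hk).1 (hp hk).2)
    (fun k => by positivity)
    (fun k hk a => (integrable_sq_pathIncrement_and_integral_le (hΦ k) (hκ _) (hp hk).1 (hp hk).2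
      hsq hAle a).2) hσpos (show 0 < (y + 1) * δ by positivity) hx)
  · refine measureReal_mono fun ω hω => ⟨?_, fun k hk => ?_⟩
    · rw [sum_pathIncrement_eq hΦ hZ hκ hκN hκstep hfm hf ω le_rfl, averageAfter_self]
      exact hω.1
    · refine (le_abs_self _).trans
        ((abs_pathIncrement_le (hΦ k) (hκ _) (hp hk).1 (hp hk).2 _ _).trans ?_)
      -- The truncation level `(y + 1) * δ` is `δ * y` for the `τ` term plus `δ` for the `ξ` term.
      have h1 : κ (k + 1) * τ k * ∫ y', dist (η k ω) y' ∂μ ≤ δ * y :=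
        mul_le_mul (hδτ k hk) (hω.2 k hk) (integral_nonneg fun _ => dist_nonneg) hδ.le
      linarith [hδξ k hk]
  · exact (pathIncrement_stoppedPath hZ (hp (show j + 1 ≤ N by omega)).2
      (hp (show j ≤ N by omega)).2 (averageAfter_eq_step (by omega)) ω fun i hi => by
        rw [stoppedPath, min_eq_left (by omega)]).symm

include hΦ hZ0 hη hZ hη_indep hZη hημ hκ hκN hκstep hfm hf in
-- Integrability follows from the pointwise bound, without any assumption on `Z 0` beyond
-- measurability and independence; Fubini then gives mean zero.
lemma integrable_and_integral_pathIncrement_stoppedPath {k : ℕ} (hk : k < N) :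
    Integrable (fun ω => pathIncrement (Φ k) μ k (averageAfter Φ μ N f (k + 1))
      (stoppedPath Z k ω) (η k ω)) P ∧
    ∫ ω, pathIncrement (Φ k) μ k (averageAfter Φ μ N f (k + 1))
      (stoppedPath Z k ω) (η k ω) ∂P = 0 := by
  have hp := averageAfter_properties hΦ hκ hκN hκstep hfm hf (show k + 1 ≤ N from hk)
  have hZm := measurable_chain (fun k => (hΦ k).measurable) hZ0 hη hZ
  have hAm := measurable_stoppedPath hZm k
  have hDm := measurable_pathIncrement (k := k) (hΦ k) hp.1
  have hint : Integrable (fun ω => pathIncrement (Φ k) μ k (averageAfter Φ μ N f (k + 1))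
      (stoppedPath Z k ω) (η k ω)) P := by
    have hG : Integrable (fun ω => ∫ y', dist (η k ω) y' ∂μ) P := by
      have h1 := integrable_integral_dist (hΦ k).integrable_dist
      rw [← hημ k] at h1
      have h2 := h1.comp_measurable (hη k)
      rw [hημ k] at h2
      exact h2
    refine (((hG.const_mul (τ k)).add (integrable_const (ξ k))).const_mul (κ (k + 1))).mono'
      (hDm.comp (hAm.prodMk (hη k))).aestronglyMeasurable (Filter.Eventually.of_forall fun ω => ?_)
    exact abs_pathIncrement_le (hΦ k) (hκ _) hp.1 hp.2 _ _
  refine ⟨hint, ?_⟩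
  have hmap : P.map (fun ω => (stoppedPath Z k ω, η k ω)) = (P.map (stoppedPath Z k)).prod μ := by
    rw [(indepFun_iff_map_prod_eq_prod_map_map hAm.aemeasurable (hη k).aemeasurable).1
      (indepFun_stoppedPath (fun k => (hΦ k).measurable) hZ0 hη hZ hη_indep hZη k), hημ k]
  have := Measure.isProbabilityMeasure_map (μ := P) hAm.aemeasurable
  have h1 := integral_map (hAm.prodMk (hη k)).aemeasurable
    (hDm.aestronglyMeasurable (μ := P.map (fun ω => (stoppedPath Z k ω, η k ω))))
  have h2 : Integrable (Function.uncurry (pathIncrement (Φ k) μ k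
      (averageAfter Φ μ N f (k + 1)))) ((P.map (stoppedPath Z k)).prod μ) := by
    rw [← hmap]
    exact (integrable_map_measure hDm.aestronglyMeasurable (hAm.prodMk (hη k)).aemeasurable).2 hint
  rw [hmap, integral_prod _ h2] at h1
  simp only [Function.uncurry_apply_pair] at h1
  rw [← h1]
  simp [integral_pathIncrement (hΦ k) (hκ _) hp.1 hp.2]

include hΦ hZ0 hη hZ hη_indep hZη hημ hκ hκN hκstep hfm hf in
/-- The functional is integrable, and its initial part is controlled by the distance of the
initial value to an independent copy. -/
theorem integrable_and_abs_averageAfter_sub_integral_le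
    (hZ0int : ∀ u, Integrable (fun ω => dist u (Z 0 ω)) P) :
    Integrable (fun ω => f (fun i => Z i ω)) P ∧
      ∀ ω, |averageAfter Φ μ N f 0 (fun i => Z i ω) - ∫ ω', f (fun i => Z i ω') ∂P| ≤
        κ 0 * ∫ ω', dist (Z 0 ω) (Z 0 ω') ∂P := by
  have hp := averageAfter_properties hΦ hκ hκN hκstep hfm hf (Nat.zero_le N)
  have hZm := measurable_chain (fun k => (hΦ k).measurable) hZ0 hη hZ
  have hlip : ∀ ω ω', |averageAfter Φ μ N f 0 (fun i => Z i ω) -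
      averageAfter Φ μ N f 0 (fun i => Z i ω')| ≤ κ 0 * dist (Z 0 ω) (Z 0 ω') := fun ω ω' => by
    simpa using hp.2 (fun i => Z i ω) (fun i => Z i ω')
  obtain ⟨ω₀⟩ : Nonempty Ω := nonempty_of_isProbabilityMeasure P
  have hm0 : Measurable fun ω => averageAfter Φ μ N f 0 (fun i => Z i ω) :=
    hp.1.comp (measurable_pi_iff.2 hZm)
  have hint0 : Integrable (fun ω => averageAfter Φ μ N f 0 (fun i => Z i ω)) P := by
    refine (((hZ0int (Z 0 ω₀)).const_mul (κ 0)).add (integrable_const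
      |averageAfter Φ μ N f 0 (fun i => Z i ω₀)|)).mono' hm0.aestronglyMeasurable
      (Filter.Eventually.of_forall fun ω => ?_)
    have h1 := hlip ω ω₀
    rw [dist_comm] at h1
    have h2 := abs_sub_abs_le_abs_sub (averageAfter Φ μ N f 0 (fun i => Z i ω))
      (averageAfter Φ μ N f 0 (fun i => Z i ω₀))
    rw [Real.norm_eq_abs, Pi.add_apply]
    linarith
  have hinc := fun k (hk : k < N) => integrable_and_integral_pathIncrement_stoppedPath hΦ hZ0 hη hZ
    hη_indep hZη hημ hκ hκN hκstep hfm hf hk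
  -- This yields the integrability of `f` along the chain, and shows that only the initial part
  -- contributes to its mean.
  have hdecomp : (fun ω => f (fun i => Z i ω)) = fun ω =>
      averageAfter Φ μ N f 0 (fun i => Z i ω) +
        ∑ j ∈ Finset.range N, pathIncrement (Φ j) μ j (averageAfter Φ μ N f (j + 1))
          (stoppedPath Z j ω) (η j ω) := by
    funext ω
    rw [sum_pathIncrement_eq hΦ hZ hκ hκN hκstep hfm hf ω le_rfl, averageAfter_self]
    ring
  have hsumint : Integrable (fun ω => ∑ j ∈ Finset.range N,
      pathIncrement (Φ j) μ j (averageAfter Φ μ N f (j + 1)) (stoppedPath Z j ω) (η j ω)) P :=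
    integrable_finsetSum _ fun j hj => (hinc j (Finset.mem_range.1 hj)).1
  have hmean : ∫ ω', f (fun i => Z i ω') ∂P =
      ∫ ω', averageAfter Φ μ N f 0 (fun i => Z i ω') ∂P := by
    rw [hdecomp, integral_add hint0 hsumint,
      integral_finsetSum _ fun j hj => (hinc j (Finset.mem_range.1 hj)).1,
      Finset.sum_eq_zero fun j hj => (hinc j (Finset.mem_range.1 hj)).2, add_zero]
  refine ⟨by rw [hdecomp]; exact hint0.add hsumint, fun ω => ?_⟩
  rw [hmean]
  calc |averageAfter Φ μ N f 0 (fun i => Z i ω) -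
        ∫ ω', averageAfter Φ μ N f 0 (fun i => Z i ω') ∂P|
      = |∫ ω', (averageAfter Φ μ N f 0 (fun i => Z i ω) -
          averageAfter Φ μ N f 0 (fun i => Z i ω')) ∂P| := by
        rw [integral_sub (integrable_const _) hint0]; simp
    _ ≤ ∫ ω', |averageAfter Φ μ N f 0 (fun i => Z i ω) -
          averageAfter Φ μ N f 0 (fun i => Z i ω')| ∂P := abs_integral_le_integral_abs
    _ ≤ ∫ ω', κ 0 * dist (Z 0 ω) (Z 0 ω') ∂P :=
        integral_mono ((integrable_const _).sub hint0).abs ((hZ0int _).const_mul _)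
          fun ω' => hlip ω ω'
    _ = _ := integral_const_mul _ _

end

end Chain

/-! ### The constants, mean distances and coordinates -/

lemma lipK_self (ρ : ℕ → ℝ) (n : ℕ) : lipK ρ n n = 1 := by
  simp [lipK]

lemma lipK_eq_one_add (ρ : ℕ → ℝ) {k n : ℕ} (hk : k < n) :
    lipK ρ k n = 1 + ρ (k + 1) * lipK ρ (k + 1) n := by
  rw [lipK, lipK, ← Finset.insert_Icc_succ_left_eq_Icc hk.le, Order.succ_eq_add_one,
    Finset.sum_insert (by simp), Finset.mul_sum]
  congr 1
  · simp
  · refine Finset.sum_congr rfl fun j hj => ?_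
    rw [← Finset.insert_Icc_succ_left_eq_Icc (Finset.mem_Icc.1 hj).1, Order.succ_eq_add_one,
      Finset.prod_insert (by simp)]

lemma lipK_nonneg {ρ : ℕ → ℝ} (hρ : ∀ k, 2 ≤ k → 0 ≤ ρ k) {k : ℕ} (hk : 1 ≤ k) (n : ℕ) :
    0 ≤ lipK ρ k n :=
  Finset.sum_nonneg fun _ _ => Finset.prod_nonneg fun l hl =>
    hρ l (by have := (Finset.mem_Icc.1 hl).1; omega)

section MeanDist

variable {E : Type*} [MetricSpace E] [TopologicalSpace.SeparableSpace E] [MeasurableSpace E]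
  [BorelSpace E] {ν : Measure E} [IsProbabilityMeasure ν]

/-- By the triangle inequality, a mean distance finite at one point is finite everywhere. -/
lemma integrable_dist_of_meanDist_ne_top {u : E} (hu : meanDist ν u ≠ ∞) (y : E) :
    Integrable (fun y' => dist y y') ν := by
  have hm : ∀ v : E, Measurable fun y' => dist v y' := fun v => measurable_const.dist measurable_id
  have h1 : Integrable (fun y' => dist u y') ν := by
    refine ⟨(hm u).aestronglyMeasurable, ?_⟩
    rw [hasFiniteIntegral_iff_ofReal (Filter.Eventually.of_forall fun _ => dist_nonneg)]
    simp only [← edist_dist]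
    exact lt_top_iff_ne_top.2 hu
  refine ((integrable_const (dist y u)).add h1).mono' (hm y).aestronglyMeasurable
    (Filter.Eventually.of_forall fun y' => ?_)
  rw [Real.norm_of_nonneg dist_nonneg]
  exact dist_triangle _ _ _

lemma meanDist_eq_ofReal {y : E} (hy : Integrable (fun y' => dist y y') ν) :
    meanDist ν y = ENNReal.ofReal (∫ y', dist y y' ∂ν) := by
  rw [ofReal_integral_eq_lintegral_ofReal hy (Filter.Eventually.of_forall fun _ => dist_nonneg)]
  simp only [← edist_dist]
  rfl

lemma measurable_meanDist : Measurable (meanDist ν) :=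
  Measurable.lintegral_prod_right (f := fun y y' : E => edist y y') measurable_edist

end MeanDist

/-- The factor is the constant in `‖v‖_p ≤ d^{1/p} ‖v‖_∞`; for `p = ∞` the exponent `p⁻¹.toReal` is
0. -/
lemma exists_le_abs_of_rpow_mul_le_norm {p : ℝ≥0∞} [Fact (1 ≤ p)] {d : ℕ} (hd : 1 ≤ d) {x : ℝ}
    (hx : 0 < x) {v : PiLp p (fun _ : Fin d => ℝ)} (hv : (d : ℝ) ^ (p⁻¹).toReal * x ≤ ‖v‖) :
    ∃ j, x ≤ |v j| := by
  by_contra! hlt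
  have hd' : (0 : ℝ) < d := by exact_mod_cast hd
  have h1 : ‖WithLp.ofLp v‖ < x := (pi_norm_lt_iff hx).2 fun j => hlt j
  have h2 := (PiLp.antilipschitzWith_ofLp p (fun _ : Fin d => ℝ)).le_mul_dist v 0
  simp only [dist_zero_right, WithLp.ofLp_zero, one_div, Fintype.card_fin, NNReal.coe_rpow,
    NNReal.coe_natCast] at h2
  have h3 : (d : ℝ) ^ (p⁻¹).toReal * ‖WithLp.ofLp v‖ < (d : ℝ) ^ (p⁻¹).toReal * x :=
    mul_lt_mul_of_pos_left h1 (Real.rpow_pos_of_pos hd' _)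
  linarith

section Coordinates

variable {𝒳 : Type*} [MetricSpace 𝒳] [TopologicalSpace.SeparableSpace 𝒳] [MeasurableSpace 𝒳]
  [BorelSpace 𝒳] {p : ℝ≥0∞} [Fact (1 ≤ p)] {d N : ℕ}
  {f : (Fin (N + 1) → 𝒳) → PiLp p (fun _ : Fin d => ℝ)}

/-- A coordinate of `f`, up to the sign `s`, as a function on infinite paths. -/
def pathCoord (f : (Fin (N + 1) → 𝒳) → PiLp p (fun _ : Fin d => ℝ)) (j : Fin d) (s : ℝ)
    (x : ℕ → 𝒳) : ℝ :=
  s * f (fun i => x i) j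

lemma lipschitzUpTo_pathCoord (hf : ∀ a b, ‖f a - f b‖ ≤ ∑ i, dist (a i) (b i)) (j : Fin d)
    {s : ℝ} (hs : |s| = 1) : LipschitzUpTo N 1 (pathCoord f j s) := by
  intro x x'
  have h1 := (PiLp.norm_apply_le (f (fun i => x i) - f (fun i => x' i)) j).trans (hf _ _)
  rw [Fin.sum_univ_eq_sum_range (fun i => dist (x i) (x' i)), Finset.sum_range_succ] at h1
  rw [pathCoord, pathCoord, ← mul_sub, abs_mul, hs, one_mul, one_mul]
  exact h1

lemma measurable_pathCoord (hf : ∀ a b, ‖f a - f b‖ ≤ ∑ i, dist (a i) (b i)) (j : Fin d)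
    (s : ℝ) : Measurable (pathCoord f j s) := by
  -- Measurability of `f` is derived from continuity: second countability identifies the Borel and
  -- product σ-algebras on the finite power.
  have := UniformSpace.secondCountable_of_separable 𝒳
  have hlip : LipschitzWith (N + 1) fun a => f a j := by
    refine LipschitzWith.of_dist_le_mul fun a b => ?_
    refine ((PiLp.norm_apply_le (f a - f b) j).trans (hf a b)).trans ?_
    refine (Finset.sum_le_card_nsmul _ _ _ fun i _ => dist_le_pi_dist a b i).trans ?_
    simp
  have hmap : Measurable fun x : ℕ → 𝒳 => fun i : Fin (N + 1) => x i := by fun_prop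
  exact (hlip.continuous.measurable.comp hmap).const_mul s

end Coordinates

/-! ### Union bound over coordinates and signs -/

section Main

variable {Ω : Type*} [MeasurableSpace Ω] {P : Measure Ω} [IsProbabilityMeasure P]
  {𝒳 𝒴 : Type*} [MetricSpace 𝒳] [TopologicalSpace.SeparableSpace 𝒳]
  [MeasurableSpace 𝒳] [BorelSpace 𝒳] [MetricSpace 𝒴] [TopologicalSpace.SeparableSpace 𝒴]
  [MeasurableSpace 𝒴] [BorelSpace 𝒴]

/-- Deviation bound for the norm of the centred functional of a chain
`Z (k + 1) = Φ k (Z k) (η k)`. -/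
theorem measureReal_norm_centred_ge_le {Φ : ℕ → 𝒳 → 𝒴 → 𝒳} {μ : Measure 𝒴}
    [IsProbabilityMeasure μ] {Z : ℕ → Ω → 𝒳} {η : ℕ → Ω → 𝒴} {r τ ξ κ : ℕ → ℝ} {N : ℕ}
    (hΦ : ∀ k, IsAverageContraction (Φ k) μ (r k) (τ k) (ξ k))
    (hZ0 : Measurable (Z 0)) (hη : ∀ k, Measurable (η k))
    (hZ : ∀ k ω, Z (k + 1) ω = Φ k (Z k ω) (η k ω)) (hη_indep : iIndepFun η P)
    (hZη : IndepFun (Z 0) (fun ω k => η k ω) P) (hημ : ∀ k, P.map (η k) = μ)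
    (hκ : ∀ k, 0 ≤ κ k) (hκN : κ N = 1) (hκstep : ∀ k < N, κ k = 1 + r k * κ (k + 1))
    (hZ0int : ∀ u, Integrable (fun ω => dist u (Z 0 ω)) P)
    (hsq : Integrable (fun y => (∫ y', dist y y' ∂μ) ^ 2) μ) {A : ℝ} (hA : 0 < A)
    (hAle : ∫ y, (∫ y', dist y y' ∂μ) ^ 2 ∂μ ≤ A) {δ y x : ℝ} (hδ : 0 < δ)
    (hδτ : ∀ k < N, κ (k + 1) * τ k ≤ δ) (hδξ : ∀ k < N, κ (k + 1) * ξ k ≤ δ)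
    (hσpos : 0 < ∑ k ∈ Finset.range N, 2 * (κ (k + 1) ^ 2 * (τ k ^ 2 * A + ξ k ^ 2)))
    (hx : 0 < x) (hy : 0 < y) {p : ℝ≥0∞} [Fact (1 ≤ p)] {d : ℕ} (hd : 1 ≤ d)
    {f : (Fin (N + 1) → 𝒳) → PiLp p (fun _ : Fin d => ℝ)}
    (hf : ∀ a b, ‖f a - f b‖ ≤ ∑ i, dist (a i) (b i)) :
    P.real {ω | (d : ℝ) ^ (p⁻¹).toReal * x ≤
        ‖f (fun i => Z i ω) - ∫ ω', f (fun i => Z i ω') ∂P‖} ≤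
      d * P.real {ω | x / 2 ≤ κ 0 * ∫ ω', dist (Z 0 ω) (Z 0 ω') ∂P} +
      2 * d * hoeffdingH (N + 1) (x / 2 / ((y + 1) * δ))
        (√(∑ k ∈ Finset.range N, 2 * (κ (k + 1) ^ 2 * (τ k ^ 2 * A + ξ k ^ 2))) /
          ((y + 1) * δ)) +
      2 * d * P.real {ω | ∃ k < N, y < ∫ y', dist (η k ω) y' ∂μ} := by
  set I : Set Ω := {ω | x / 2 ≤ κ 0 * ∫ ω', dist (Z 0 ω) (Z 0 ω') ∂P} with hI
  set B : Set Ω := {ω | ∃ k < N, y < ∫ y', dist (η k ω) y' ∂μ} with hB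
  set H := hoeffdingH (N + 1) (x / 2 / ((y + 1) * δ))
        (√(∑ k ∈ Finset.range N, 2 * (κ (k + 1) ^ 2 * (τ k ^ 2 * A + ξ k ^ 2))) /
          ((y + 1) * δ)) with hH
  let C : Fin d → ℝ → Set Ω := fun j s =>
    {ω | x / 2 ≤ pathCoord f j s (fun i => Z i ω) -
        averageAfter Φ μ N (pathCoord f j s) 0 (fun i => Z i ω) ∧
      ∀ k < N, ∫ y', dist (η k ω) y' ∂μ ≤ y}
  have hC : ∀ j s, |s| = 1 → P.real (C j s) ≤ H := fun j s hs =>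
    measureReal_sub_averageAfter_ge_le hΦ hZ0 hη hZ hη_indep hZη hημ hκ hκN hκstep
      (measurable_pathCoord hf j s) (lipschitzUpTo_pathCoord hf j hs) hsq hA hAle hδ hδτ hδξ
      hσpos (by positivity) hy (Nat.lt_succ_self N)
  have hinit := fun j s (hs : |s| = 1) => integrable_and_abs_averageAfter_sub_integral_le hΦ hZ0 hη
    hZ hη_indep hZη hημ hκ hκN hκstep (measurable_pathCoord hf j s)
    (lipschitzUpTo_pathCoord hf j hs) hZ0int
  have htail : ∀ j s, |s| = 1 → ∀ ω,
      x ≤ pathCoord f j s (fun i => Z i ω) - ∫ ω', pathCoord f j s (fun i => Z i ω') ∂P →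
      ω ∈ I ∪ B ∪ C j s := by
    intro j s hs ω hω
    by_contra hnot
    simp only [Set.mem_union, not_or] at hnot
    obtain ⟨⟨hnI, hnB⟩, hnC⟩ := hnot
    simp only [hI, hB, Set.mem_ofPred_eq, not_le, not_exists, not_and, not_lt] at hnI hnB
    have h1 := le_of_abs_le ((hinit j s hs).2 ω)
    have h2 : x / 2 ≤ pathCoord f j s (fun i => Z i ω) -
        averageAfter Φ μ N (pathCoord f j s) 0 (fun i => Z i ω) := by linarith
    exact hnC ⟨h2, hnB⟩
  have hint : ∀ j, Integrable (fun ω => f (fun i => Z i ω) j) P := fun j => by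
    simpa [pathCoord] using (hinit j 1 abs_one).1
  -- `I` and `B` depend neither on the coordinate nor on the sign, so they are counted once; their
  -- factors `d` and `2 * d` are inserted only at the end.
  have hsub : {ω | (d : ℝ) ^ (p⁻¹).toReal * x ≤
      ‖f (fun i => Z i ω) - ∫ ω', f (fun i => Z i ω') ∂P‖} ⊆
      I ∪ B ∪ ⋃ j, (C j 1 ∪ C j (-1)) := by
    intro ω hω
    obtain ⟨j, hj⟩ := exists_le_abs_of_rpow_mul_le_norm hd hx hω
    rw [PiLp.sub_apply, eval_integral_piLp hint j] at hj
    rcases le_abs.1 hj with h | h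
    · rcases htail j 1 abs_one ω (by simpa [pathCoord] using h) with h | h
      · exact Or.inl h
      · exact Or.inr (Set.mem_iUnion.2 ⟨j, Or.inl h⟩)
    · have h' : x ≤ pathCoord f j (-1) (fun i => Z i ω) -
          ∫ ω', pathCoord f j (-1) (fun i => Z i ω') ∂P := by
        simp only [pathCoord, neg_one_mul, integral_neg]
        linarith
      rcases htail j (-1) (by simp) ω h' with h | h
      · exact Or.inl h
      · exact Or.inr (Set.mem_iUnion.2 ⟨j, Or.inr h⟩)
  have hunion : P.real (⋃ j, (C j 1 ∪ C j (-1))) ≤ 2 * d * H := by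
    refine (measureReal_iUnion_fintype_le _).trans ?_
    calc ∑ j, P.real (C j 1 ∪ C j (-1)) ≤ ∑ _j : Fin d, (H + H) := Finset.sum_le_sum fun j _ =>
          (measureReal_union_le _ _).trans (add_le_add (hC j 1 abs_one) (hC j (-1) (by simp)))
      _ = 2 * d * H := by simp; ring
  have hd' : (1 : ℝ) ≤ d := by exact_mod_cast hd
  have hP := (measureReal_mono hsub).trans ((measureReal_union_le _ _).trans
    (add_le_add (measureReal_union_le (μ := P) I B) hunion))
  have hI0 : 0 ≤ P.real I := measureReal_nonneg
  have hB0 : 0 ≤ P.real B := measureReal_nonneg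
  have hI1 : P.real I ≤ d * P.real I := le_mul_of_one_le_left hI0 hd'
  have hB1 : P.real B ≤ 2 * d * P.real B := le_mul_of_one_le_left hB0 (by linarith)
  linarith

end Main

/-! ### Transfer to the chain indexed from 1 -/

theorem proposition3p7
    {Ω : Type*} [MeasurableSpace Ω] (P : Measure Ω) [IsProbabilityMeasure P]
    {𝒳 : Type*} [MetricSpace 𝒳] [CompleteSpace 𝒳] [TopologicalSpace.SeparableSpace 𝒳]
    [MeasurableSpace 𝒳] [BorelSpace 𝒳]
    {𝒴 : Type*} [MetricSpace 𝒴] [CompleteSpace 𝒴] [TopologicalSpace.SeparableSpace 𝒴]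
    [MeasurableSpace 𝒴] [BorelSpace 𝒴]
    -- the i.i.d. sequence `(ε_k)_{k ≥ 1}` of copies of `ε₀`
    (ε₀ : Ω → 𝒴) (ε : ℕ → Ω → 𝒴)
    (hε_iid : ∀ k, 1 ≤ k → IdentDistrib (ε k) ε₀ P P)
    (hε_meas : ∀ k, 1 ≤ k → Measurable (ε k))
    (hε_indep : iIndepFun (fun k : ℕ => ε (k + 1)) P)
    -- the chain `(X_k)_{k ≥ 1}`
    (F : ℕ → 𝒳 → 𝒴 → 𝒳)
    (hF_meas : ∀ k, 2 ≤ k → Measurable (Function.uncurry (F k)))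
    (X : ℕ → Ω → 𝒳)
    (hX₁_meas : Measurable (X 1))
    (hX₁_indep : IndepFun (X 1) (fun ω (k : ℕ) => ε (k + 2) ω) P)
    (hX : ∀ k, 2 ≤ k → ∀ ω, X k ω = F k (X (k - 1) ω) (ε k ω))
    -- contraction on average in the first variable, Lipschitz-type bound in the second one
    (ρ τ ξ : ℕ → ℝ)
    (hρ : ∀ k, 2 ≤ k → 0 ≤ ρ k ∧ ρ k < 1)
    (hτ : ∀ k, 2 ≤ k → 0 ≤ τ k)
    (hξ : ∀ k, 2 ≤ k → 0 ≤ ξ k)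
    (hF_contract : ∀ k, 2 ≤ k → ∀ x x' : 𝒳,
      ∫⁻ ω, edist (F k x (ε 1 ω)) (F k x' (ε 1 ω)) ∂P ≤ ENNReal.ofReal (ρ k) * edist x x')
    (hF_lip : ∀ k, 2 ≤ k → ∀ (x : 𝒳) (y y' : 𝒴),
      dist (F k x y) (F k x y') ≤ τ k * dist y y' + ξ k)
    -- the separately Lipschitz function `f`
    (p : ℝ≥0∞) [Fact (1 ≤ p)] (d n : ℕ) (hd : 1 ≤ d) (hn : 2 ≤ n)
    (f : (Fin n → 𝒳) → PiLp p (fun _ : Fin d => ℝ))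
    (hf : ∀ a b : Fin n → 𝒳, ‖f a - f b‖ ≤ ∑ i, dist (a i) (b i))
    -- the moment condition `𝔼[G_ε(ε)²] ≤ A₁`
    (A₁ : ℝ) (hA₁ : 0 < A₁)
    (hmoment : ∫⁻ ω, meanDist (P.map ε₀) (ε₀ ω) ^ 2 ∂P ≤ ENNReal.ofReal A₁)
    -- the bound divides by `δ_n`
    (hδ : 0 < hoeffdingDelta ρ τ ξ n hn) :
    (∀ x y : ℝ, 0 < x → 0 < y →
      P.real {ω | (d : ℝ) ^ (p⁻¹).toReal * x ≤ ‖centredSum P f X ω‖} ≤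
        initialTerm P d n ρ (X 1) x
        + 2 * d * hoeffdingH n (x / (2 * (y + 1) * hoeffdingDelta ρ τ ξ n hn))
            (hoeffdingV ρ τ ξ A₁ n / ((y + 1) * hoeffdingDelta ρ τ ξ n hn))
        + 2 * d * P.real {ω | ENNReal.ofReal y <
            (Finset.Icc 2 n).sup (fun k => meanDist (P.map ε₀) (ε k ω))}) ∧
    (∀ T : ℝ, 0 < T → (∀ᵐ ω ∂P, meanDist (P.map ε₀) (ε₀ ω) ≤ ENNReal.ofReal T) →
      ∀ x : ℝ, 0 < x →
        P.real {ω | (d : ℝ) ^ (p⁻¹).toReal * x ≤ ‖centredSum P f X ω‖} ≤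
          initialTerm P d n ρ (X 1) x
          + 2 * d * hoeffdingH n (x / (2 * (T + 1) * hoeffdingDelta ρ τ ξ n hn))
              (hoeffdingV ρ τ ξ A₁ n / ((T + 1) * hoeffdingDelta ρ τ ξ n hn))) := by
  have := UniformSpace.secondCountable_of_separable 𝒳
  have := UniformSpace.secondCountable_of_separable 𝒴
  have hε₀ : AEMeasurable ε₀ P := (hε_iid 1 le_rfl).aemeasurable_snd
  set μ := P.map ε₀ with hμ
  have hμprob : IsProbabilityMeasure μ := Measure.isProbabilityMeasure_map hε₀
  have hεμ : ∀ k, 1 ≤ k → P.map (ε k) = μ := fun k hk => (hε_iid k hk).map_eq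
  have hmoment' : ∫⁻ y, meanDist μ y ^ 2 ∂μ ≤ ENNReal.ofReal A₁ := by
    rw [hμ, lintegral_map' (measurable_meanDist.pow_const 2).aemeasurable hε₀]
    exact hmoment
  -- The second moment makes `G_ε` finite almost everywhere, hence at some point, hence everywhere.
  obtain ⟨y₀, hy₀⟩ : ∃ y₀, meanDist μ y₀ ≠ ∞ := by
    have hfin := ae_lt_top (measurable_meanDist.pow_const 2)
      (hmoment'.trans_lt ENNReal.ofReal_lt_top).ne
    obtain ⟨y₀, hy₀⟩ := hfin.exists
    exact ⟨y₀, fun h => by simp [h] at hy₀⟩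
  have hdist := integrable_dist_of_meanDist_ne_top hy₀
  have hG : ∀ y, meanDist μ y = ENNReal.ofReal (∫ y', dist y y' ∂μ) := fun y =>
    meanDist_eq_ofReal (hdist y)
  have hG0 : ∀ y, 0 ≤ ∫ y', dist y y' ∂μ := fun y => integral_nonneg fun _ => dist_nonneg
  have hGsq : ∫⁻ y, ENNReal.ofReal ((∫ y', dist y y' ∂μ) ^ 2) ∂μ ≤ ENNReal.ofReal A₁ := by
    simpa only [ENNReal.ofReal_pow (hG0 _), ← hG] using hmoment'
  have hsqm : AEStronglyMeasurable (fun y => (∫ y', dist y y' ∂μ) ^ 2) μ :=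
    ((measurable_integral_dist μ).pow_const 2).aestronglyMeasurable
  have hsq : Integrable (fun y => (∫ y', dist y y' ∂μ) ^ 2) μ := by
    refine ⟨hsqm, ?_⟩
    rw [hasFiniteIntegral_iff_ofReal (Filter.Eventually.of_forall fun _ => sq_nonneg _)]
    exact hGsq.trans_lt ENNReal.ofReal_lt_top
  have hAle : ∫ y, (∫ y', dist y y' ∂μ) ^ 2 ∂μ ≤ A₁ := by
    rw [integral_eq_lintegral_of_nonneg_ae (Filter.Eventually.of_forall fun _ => sq_nonneg _) hsqm]
    exact ENNReal.toReal_le_of_le_ofReal hA₁.le hGsq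
  have hΦ : ∀ k, IsAverageContraction (F (k + 2)) μ (ρ (k + 2)) (τ (k + 2)) (ξ (k + 2)) := by
    intro k
    have hk : 2 ≤ k + 2 := by omega
    refine ⟨hF_meas _ hk, hdist, fun u u' => ?_, hF_lip _ hk, (hρ _ hk).1, hτ _ hk, hξ _ hk⟩
    have hm : Measurable fun y => edist (F (k + 2) u y) (F (k + 2) u' y) :=
      ((hF_meas _ hk).comp measurable_prodMk_left).edist
        ((hF_meas _ hk).comp measurable_prodMk_left)
    rw [← hεμ 1 le_rfl, lintegral_map hm (hε_meas 1 le_rfl)]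
    exact hF_contract _ hk u u'
  -- `N` counts the transitions: `X (k + 1)` becomes `Z k` and `ε (k + 2)` becomes `η k`.
  obtain ⟨N, rfl⟩ : ∃ N, n = N + 1 := ⟨n - 1, by omega⟩
  have hδle : ∀ k < N, max (lipK ρ (k + 2) (N + 1) * τ (k + 2))
      (lipK ρ (k + 2) (N + 1) * ξ (k + 2)) ≤ hoeffdingDelta ρ τ ξ (N + 1) hn := fun k hk =>
    Finset.le_sup' (fun k => max (lipK ρ k (N + 1) * τ k) (lipK ρ k (N + 1) * ξ k))
      (Finset.mem_Icc.2 ⟨by omega, by omega⟩)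
  have hsum : 2 * ∑ k ∈ Finset.Icc 2 (N + 1),
      lipK ρ k (N + 1) ^ 2 * (τ k ^ 2 * A₁ + ξ k ^ 2) = ∑ k ∈ Finset.range N,
      2 * (lipK ρ (k + 1 + 1) (N + 1) ^ 2 * (τ (k + 2) ^ 2 * A₁ + ξ (k + 2) ^ 2)) := by
    have hIcc : Finset.Icc 2 (N + 1) = Finset.Ico 2 (N + 2) := by
      ext i; simp only [Finset.mem_Icc, Finset.mem_Ico]; omega
    rw [Finset.mul_sum, hIcc, Finset.sum_Ico_eq_sum_range]
    refine Finset.sum_congr (by simp) fun k _ => ?_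
    rw [add_comm 2 k]
  have hσpos : 0 < ∑ k ∈ Finset.range N,
      2 * (lipK ρ (k + 1 + 1) (N + 1) ^ 2 * (τ (k + 2) ^ 2 * A₁ + ξ (k + 2) ^ 2)) := by
    rw [← hsum]
    -- An index where `K τ` or `K ξ` is positive also makes its summand in `V_n²` positive.
    obtain ⟨k, hk, hpos⟩ := (Finset.lt_sup'_iff _).1 hδ
    refine mul_pos two_pos (Finset.sum_pos' (fun _ _ => by positivity) ⟨k, hk, ?_⟩)
    rcases lt_max_iff.1 hpos with h | h
    · have h1 := left_ne_zero_of_mul h.ne'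
      have h2 := right_ne_zero_of_mul h.ne'
      positivity
    · have h1 := left_ne_zero_of_mul h.ne'
      have h2 := right_ne_zero_of_mul h.ne'
      positivity
  have hbad : ∀ {ω : Ω} {y : ℝ}, ENNReal.ofReal y <
      (Finset.Icc 2 (N + 1)).sup (fun k => meanDist μ (ε k ω)) ↔
      ∃ k ∈ Finset.Icc 2 (N + 1), ENNReal.ofReal y < meanDist μ (ε k ω) :=
    fun {_ _} => Finset.lt_sup_iff
  have main : ∀ x y : ℝ, 0 < x → 0 < y →
      P.real {ω | (d : ℝ) ^ (p⁻¹).toReal * x ≤ ‖centredSum P f X ω‖} ≤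
        initialTerm P d (N + 1) ρ (X 1) x
        + 2 * d * hoeffdingH (N + 1) (x / (2 * (y + 1) * hoeffdingDelta ρ τ ξ (N + 1) hn))
            (hoeffdingV ρ τ ξ A₁ (N + 1) / ((y + 1) * hoeffdingDelta ρ τ ξ (N + 1) hn))
        + 2 * d * P.real {ω | ENNReal.ofReal y <
            (Finset.Icc 2 (N + 1)).sup (fun k => meanDist μ (ε k ω))} := by
    intro x y hx hy
    have hd' : (1 : ℝ) ≤ d := by exact_mod_cast hd
    have hH := hoeffdingH_nonneg (N + 1) (x / (2 * (y + 1) * hoeffdingDelta ρ τ ξ (N + 1) hn))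
      (hoeffdingV ρ τ ξ A₁ (N + 1) / ((y + 1) * hoeffdingDelta ρ τ ξ (N + 1) hn)) (by positivity)
    have := Measure.isProbabilityMeasure_map (μ := P) hX₁_meas.aemeasurable
    -- If `G_{X₁}` is identically infinite, the initial term is `d ≥ 1` and bounds any probability;
    -- otherwise `X 1` has an integrable distance to every point.
    by_cases hX₁ : ∀ u, meanDist (P.map (X 1)) u = ∞
    · have hI : initialTerm P d (N + 1) ρ (X 1) x = d := by
        simp [initialTerm, hX₁]
      have h1 : P.real {ω | (d : ℝ) ^ (p⁻¹).toReal * x ≤ ‖centredSum P f X ω‖} ≤ 1 :=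
        measureReal_le_one
      have h2 : 0 ≤ P.real {ω | ENNReal.ofReal y <
          (Finset.Icc 2 (N + 1)).sup (fun k => meanDist μ (ε k ω))} := measureReal_nonneg
      rw [hI]
      have h3 : (0 : ℝ) ≤ 2 * d := by linarith
      linarith [mul_nonneg h3 hH, mul_nonneg h3 h2]
    push Not at hX₁
    obtain ⟨u₀, hu₀⟩ := hX₁
    have hdX := integrable_dist_of_meanDist_ne_top hu₀
    have hκ0 : ∀ k, 0 ≤ lipK ρ (k + 1) (N + 1) := fun k =>
      lipK_nonneg (fun k hk => (hρ k hk).1) (by omega) _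
    have hκpos : 0 < lipK ρ 1 (N + 1) := by
      rw [lipK_eq_one_add ρ (show 1 < N + 1 by omega)]
      have := mul_nonneg (hρ 2 le_rfl).1 (hκ0 1)
      linarith
    have key := measureReal_norm_centred_ge_le (P := P) (μ := μ) (Φ := fun k => F (k + 2))
      (Z := fun k => X (k + 1)) (η := fun k => ε (k + 2)) (κ := fun k => lipK ρ (k + 1) (N + 1))
      (N := N) hΦ hX₁_meas (fun k => hε_meas _ (by omega))
      (fun k ω => hX (k + 2) (by omega) ω)
      (hε_indep.precomp (g := fun k => k + 1) (add_left_injective 1)) hX₁_indep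
      (fun k => hεμ _ (by omega)) hκ0 (lipK_self ρ _)
      (fun k hk => lipK_eq_one_add ρ (by omega)) (fun u => (hdX u).comp_measurable hX₁_meas) hsq hA₁
      hAle hδ (fun k hk => (le_max_left _ _).trans (hδle k hk))
      (fun k hk => (le_max_right _ _).trans (hδle k hk)) hσpos hx hy hd hf
    have hxeq : x / 2 / ((y + 1) * hoeffdingDelta ρ τ ξ (N + 1) hn) =
        x / (2 * (y + 1) * hoeffdingDelta ρ τ ξ (N + 1) hn) := by
      rw [div_div, mul_assoc]
    rw [hxeq, ← hsum] at key
    refine key.trans (add_le_add (add_le_add ?_ le_rfl) ?_)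
    · refine mul_le_mul_of_nonneg_left (measureReal_mono fun ω hω => ?_) (by linarith)
      have h1 : ∫ u, dist (X 1 ω) u ∂(P.map (X 1)) = ∫ ω', dist (X 1 ω) (X 1 ω') ∂P :=
        integral_map hX₁_meas.aemeasurable (hdX _).1
      show ENNReal.ofReal (x / (2 * lipK ρ 1 (N + 1))) ≤ meanDist (P.map (X 1)) (X 1 ω)
      rw [meanDist_eq_ofReal (hdX _), h1]
      refine ENNReal.ofReal_le_ofReal ?_
      have h2 : x / 2 ≤ lipK ρ 1 (N + 1) * ∫ ω', dist (X 1 ω) (X 1 ω') ∂P := hω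
      rw [← div_div, div_le_iff₀ hκpos, mul_comm]
      exact h2
    · refine mul_le_mul_of_nonneg_left (measureReal_mono ?_) (by linarith)
      rintro ω ⟨k, hk, hlt⟩
      refine hbad.2 ⟨k + 2, Finset.mem_Icc.2 ⟨by omega, by omega⟩, ?_⟩
      rw [hG]
      exact (ENNReal.ofReal_lt_ofReal_iff_of_nonneg hy.le).2 hlt
  refine ⟨main, fun T hT hbound x hx => ?_⟩
  have hnull : P.real {ω | ENNReal.ofReal T <
      (Finset.Icc 2 (N + 1)).sup (fun k => meanDist μ (ε k ω))} = 0 := by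
    rw [measureReal_eq_zero_iff]
    -- The almost sure bound passes from `ε₀` to each `ε k` by equality in law, so `y = T` makes the
    -- last term vanish.
    have hall : ∀ᵐ ω ∂P, ∀ k ∈ Finset.Icc 2 (N + 1), meanDist μ (ε k ω) ≤ ENNReal.ofReal T := by
      refine (ae_ball_iff (Finset.countable_toSet _)).2 fun k hk => ?_
      exact (hε_iid k (by have := (Finset.mem_Icc.1 hk).1; omega)).symm.ae_snd
        (p := fun y => meanDist μ y ≤ ENNReal.ofReal T)
        (measurableSet_le measurable_meanDist measurable_const) hbound
    refine measure_mono_null ?_ (ae_iff.1 hall)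
    intro ω hω hω'
    obtain ⟨k, hk, hlt⟩ := hbad.1 hω
    exact absurd (hω' k hk) (not_le.2 hlt)
  have h1 := main x T hx hT
  rwa [hnull, mul_zero, add_zero] at h1
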